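/- **Setting.** Let $\mathcal F_{\rm rad}=\bigoplus_{n\ge 0}\bigotimes_s^n L^2(\mathbb R^3\times\{1,2\})$ be the boson Fock space, with annihilation and creation operators $a(f)$, $a(f)^*$ and second quantizations $d\Gamma(\cdot)$, $\Gamma(\cdot)$. Let $\alpha_1,\alpha_2,\alpha_3,\beta$ be Dirac matrices, i.e. Hermitian complex $4\times4$ matrices with $\alpha_j\alpha_l+\alpha_l\alpha_j=2\delta_{jl}$, $\alpha_j\beta+\beta\alpha_j=0$, $\beta^2=1$. Let $\mathbf e^{(1)},\mathbf e^{(2)}:\mathbb R^3\to\mathbb R^3$ be polarization vectors, i.e. Borel measurable maps with $\mathbf e^{(\lambda)}(\mathbf k)\cdot\mathbf e^{(\mu)}(\mathbf k)=\delta_{\lambda\mu}$ and $\mathbf e^{(\lambda)}(\mathbf k)\cdot\mathbf k=0$ for all $\mathbf k$. Let $\rho:\mathbb R^3\to\mathbb C$ satisfy $\rho\in L^2(\mathbb R^3)$ and $|\mathbf k|^{-1}\rho\in L^2(\mathbb R^3)$, let $M,q\in\mathbb R$ and $m\ge0$. Put $g_j(\mathbf k,\lambda)=|\mathbf k|^{-1/2}\rho(\mathbf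 k)e^{(\lambda)}_j(\mathbf k)$, let $A_j$ be the closure of $2^{-1/2}\,(a(g_j)+a(g_j)^*)$, and let $\omega_m(\mathbf k)=(1+m)|\mathbf k|+m$. For $\mathbf p\in\mathbb R^3$ define on $\mathbb C^4\otimes\mathcal F_{\rm rad}$, on its natural domain, $$H_m(\mathbf p)=\sum_{j=1}^3\alpha_jp_j+M\beta+d\Gamma(\omega_m)-\sum_{j=1}^3\alpha_j\,d\Gamma(k_j)-q\sum_{j=1}^3\alpha_jA_j,$$ and put $E_m(\mathbf p)=\inf\sigma(\overline{H_m(\mathbf p)})$, where the bar denotes the closure. **Proposition (Symmetry in the total momentum).** Let $T\in O(3)$ be such that $|\rho(\mathbf k)|=|\rho(T\mathbf k)|$ for almost every $\mathbf k\in\mathbb R^3$. Then for every $\mathbf p\in\mathbb R^3$ the operator $\overline{H_m(\mathbf p)}$ is unitarily equivalent to $\overline{H_m(T\mathbf p)}$, and $E_m(\mathbf p)=E_m(T\mathbf p)$. Moreover, a unitary operator $U$ with $U\,\overline{H_m(\mathbf p)}\,U^{-1}=\overline{H_m(T\mathbf p)}$ can be chosen of the form $U=u_T\otimes\Gamma(W)$,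 where $u_T$ is a unitary $4\times4$ matrix with $u_T\alpha_ju_T^{-1}=\sum_{l}T_{lj}\alpha_l$ for $j=1,2,3$ and $u_T\beta u_T^{-1}=\beta$, and where $W$ is the unitary operator on $L^2(\mathbb R^3\times\{1,2\})$ given by $$(Wf)(\mathbf k,\lambda)=\sum_{\mu=1}^2B(\mathbf k)_{\lambda\mu}\,f(T^{-1}\mathbf k,\mu)$$ for some measurable function $\mathbf k\mapsto B(\mathbf k)$ with values in the unitary $2\times2$ matrices. -/

import Mathlib

open MeasureTheory
open scoped InnerProductSpace

noncomputable section

namespace DiracPolaron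

/-- Momentum space `ℝ³` with the Euclidean norm. -/
abbrev R3 : Type := EuclideanSpace ℝ (Fin 3)

/-- The one-photon configuration space `ℝ³ × {1,2}` (wave vector, polarization label). -/
abbrev Mode : Type := R3 × Fin 2

/-- Lebesgue measure times counting measure on `ℝ³ × {1,2}`. -/
def modeMeasure : Measure Mode := (volume : Measure R3).prod Measure.count

instance : SigmaFinite modeMeasure := by unfold modeMeasure; infer_instance

/-- Product measure on `(ℝ³ × {1,2})ⁿ`. -/
def nMeasure (n : ℕ) : Measure (Fin n → Mode) := Measure.pi fun _ => modeMeasure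

instance (n : ℕ) : SigmaFinite (nMeasure n) := by unfold nMeasure; infer_instance

/-- The one-photon Hilbert space `L²(ℝ³ × {1,2})`. -/
abbrev OnePhoton : Type := Lp ℂ 2 modeMeasure

/-! ### Boson Fock space -/

theorem measurePreserving_perm {n : ℕ} (σ : Equiv.Perm (Fin n)) :
    MeasurePreserving (fun x : Fin n → Mode => x ∘ σ) (nMeasure n) (nMeasure n) := by
  have h := measurePreserving_piCongrLeft (α := fun _ : Fin n => Mode)
    (fun _ : Fin n => modeMeasure) σ⁻¹
  have e : (fun x : Fin n → Mode => x ∘ σ)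
      = MeasurableEquiv.piCongrLeft (fun _ : Fin n => Mode) σ⁻¹ := by
    funext x i
    have := Equiv.piCongrLeft_apply_apply (fun _ : Fin n => Mode) σ⁻¹ x (σ i)
    change x (σ i) = Equiv.piCongrLeft (fun _ : Fin n => Mode) σ⁻¹ x i
    simpa using this.symm
  rw [e]
  exact h

/-- The `n`-photon space `⊗ₛⁿ L²(ℝ³ × {1,2})`, realised as the space of square integrable functions
on `(ℝ³ × {1,2})ⁿ` that are invariant under permutations of the `n` arguments. -/
def Sector (n : ℕ) : Submodule ℂ (Lp ℂ 2 (nMeasure n)) :=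
  ⨅ σ : Equiv.Perm (Fin n),
    LinearMap.eqLocus
      (Lp.compMeasurePreservingₗᵢ ℂ (fun x : Fin n → Mode => x ∘ σ)
        (measurePreserving_perm σ)).toLinearMap
      LinearMap.id

theorem mem_Sector_iff {n : ℕ} (f : Lp ℂ 2 (nMeasure n)) :
    f ∈ Sector n ↔
      ∀ σ : Equiv.Perm (Fin n), ∀ᵐ x ∂(nMeasure n), f (x ∘ σ) = f x := by
  simp only [Sector, Submodule.mem_iInf, LinearMap.mem_eqLocus]
  refine forall_congr' fun σ => ?_
  have h := Lp.coeFn_compMeasurePreserving f (measurePreserving_perm σ)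
  constructor
  · intro hσ
    have hσ' : Lp.compMeasurePreserving _ (measurePreserving_perm σ) f = f := hσ
    rw [hσ'] at h
    filter_upwards [h] with x hx using hx.symm
  · intro hσ
    change Lp.compMeasurePreserving _ (measurePreserving_perm σ) f = f
    refine Lp.ext ?_
    filter_upwards [h, hσ] with x hx hx' using hx.trans hx'

theorem isClosed_Sector (n : ℕ) : IsClosed (Sector n : Set (Lp ℂ 2 (nMeasure n))) := by
  simp only [Sector, Submodule.coe_iInf]
  refine isClosed_iInter fun σ => ?_
  exact isClosed_eq (Lp.compMeasurePreservingₗᵢ ℂ (fun x : Fin n → Mode => x ∘ σ)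
        (measurePreserving_perm σ)).continuous continuous_id

instance (n : ℕ) : CompleteSpace (Sector n) := (isClosed_Sector n).completeSpace_coe

/-- The boson Fock space `⨁ₙ ⊗ₛⁿ L²(ℝ³ × {1,2})` (Hilbert space direct sum). -/
abbrev Fock : Type := lp (fun n : ℕ => Sector n) 2

/-- The `n`-photon component of a Fock space vector, as a function on `(ℝ³ × {1,2})ⁿ`. -/
def comp (ψ : Fock) (n : ℕ) : (Fin n → Mode) → ℂ := ((ψ n : Lp ℂ 2 (nMeasure n)) : _ → ℂ)

theorem comp_add (ψ φ : Fock) (n : ℕ) :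
    ∀ᵐ x ∂(nMeasure n), comp (ψ + φ) n x = comp ψ n x + comp φ n x :=
  Lp.coeFn_add (ψ n : Lp ℂ 2 (nMeasure n)) (φ n : Lp ℂ 2 (nMeasure n))

theorem comp_smul (c : ℂ) (ψ : Fock) (n : ℕ) :
    ∀ᵐ x ∂(nMeasure n), comp (c • ψ) n x = c * comp ψ n x :=
  Lp.coeFn_smul c (ψ n : Lp ℂ 2 (nMeasure n))

theorem comp_zero (n : ℕ) : ∀ᵐ x ∂(nMeasure n), comp (0 : Fock) n x = 0 :=
  Lp.coeFn_zero ℂ 2 (nMeasure n)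

theorem comp_ext {ψ φ : Fock} (h : ∀ n, ∀ᵐ x ∂(nMeasure n), comp ψ n x = comp φ n x) : ψ = φ := by
  refine lp.ext ?_
  funext n
  exact Subtype.ext (Lp.ext (h n))

/-! ### Second quantized multiplication operators -/

/-- The graph of `dΓ(h)` for the operator of multiplication by `h(k)`: pairs `(ψ, φ)` with
`φₙ(k₁,λ₁,…,kₙ,λₙ) = (h(k₁) + ⋯ + h(kₙ)) ψₙ(k₁,λ₁,…,kₙ,λₙ)` for all `n`. -/
def dGammaGraph (h : R3 → ℝ) : Submodule ℂ (Fock × Fock) where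
  carrier := {z | ∀ n, ∀ᵐ x ∂(nMeasure n),
    comp z.2 n x = ((∑ i, h (x i).1 : ℝ) : ℂ) * comp z.1 n x}
  zero_mem' := by
    intro n
    filter_upwards [comp_zero n] with x hx
    simp [hx]
  add_mem' := by
    intro a b ha hb n
    filter_upwards [ha n, hb n, comp_add a.1 b.1 n, comp_add a.2 b.2 n] with x h1 h2 h3 h4
    simp only [Prod.fst_add, Prod.snd_add]
    rw [h3, h4, h1, h2]; ring
  smul_mem' := by
    intro c a ha n
    filter_upwards [ha n, comp_smul c a.1 n, comp_smul c a.2 n] with x h1 h3 h4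
    simp only [Prod.smul_fst, Prod.smul_snd]
    rw [h3, h4, h1]; ring

theorem dGammaGraph_functional (h : R3 → ℝ) (z : Fock × Fock) (hz : z ∈ dGammaGraph h)
    (h0 : z.1 = 0) : z.2 = 0 := by
  refine comp_ext fun n => ?_
  filter_upwards [hz n, comp_zero n] with x hx hx0
  rw [hx, h0, hx0, mul_zero]

/-- The second quantization `dΓ(h)` of the multiplication operator `h`, on its maximal domain. -/
def dGamma (h : R3 → ℝ) : Fock →ₗ.[ℂ] Fock := (dGammaGraph h).toLinearPMap

theorem dGamma_graph (h : R3 → ℝ) : (dGamma h).graph = dGammaGraph h :=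
  Submodule.toLinearPMap_graph_eq _ (dGammaGraph_functional h)

/-! ### Creation and annihilation operators -/

theorem quasiMeasurePreserving_remove {n : ℕ} (i : Fin (n + 1)) :
    Measure.QuasiMeasurePreserving (fun x : Fin (n + 1) → Mode => x ∘ i.succAbove)
      (nMeasure (n + 1)) (nMeasure n) := by
  have h := measurePreserving_piFinSuccAbove (fun _ : Fin (n + 1) => modeMeasure) i
  exact Measure.quasiMeasurePreserving_snd.comp h.quasiMeasurePreserving

/-- The graph of the creation operator `a(f)*`: pairs `(ψ, φ)` with `φ₀ = 0` and
`φₙ₊₁(x₀,…,xₙ) = (n+1)^(-1/2) ∑ᵢ f(xᵢ) ψₙ(x₀,…,xᵢ₋₁,xᵢ₊₁,…,xₙ)`. -/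
def creationGraph (f : Mode → ℂ) : Submodule ℂ (Fock × Fock) where
  carrier := {z | z.2 0 = 0 ∧ ∀ n, ∀ᵐ x ∂(nMeasure (n + 1)),
    comp z.2 (n + 1) x =
      ((Real.sqrt (n + 1))⁻¹ : ℝ) * ∑ i : Fin (n + 1), f (x i) * comp z.1 n (x ∘ i.succAbove)}
  zero_mem' := by
    refine ⟨rfl, fun n => ?_⟩
    have h : ∀ᵐ x ∂(nMeasure (n + 1)), ∀ i : Fin (n + 1),
        comp (0 : Fock) n (x ∘ i.succAbove) = 0 :=
      ae_all_iff.2 fun i => (quasiMeasurePreserving_remove i).ae (comp_zero n)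
    filter_upwards [comp_zero (n + 1), h] with x hx hx'
    simp [hx, hx']
  add_mem' := by
    intro a b ha hb
    refine ⟨?_, fun n => ?_⟩
    · have : (a + b).2 0 = a.2 0 + b.2 0 := rfl
      rw [this, ha.1, hb.1, add_zero]
    have h : ∀ᵐ x ∂(nMeasure (n + 1)), ∀ i : Fin (n + 1),
        comp (a.1 + b.1) n (x ∘ i.succAbove)
          = comp a.1 n (x ∘ i.succAbove) + comp b.1 n (x ∘ i.succAbove) :=
      ae_all_iff.2 fun i => (quasiMeasurePreserving_remove i).ae (comp_add a.1 b.1 n)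
    filter_upwards [ha.2 n, hb.2 n, comp_add a.2 b.2 (n + 1), h] with x h1 h2 h3 h4
    simp only [Prod.fst_add, Prod.snd_add]
    rw [h3, h1, h2, ← mul_add, ← Finset.sum_add_distrib]
    simp only [h4, mul_add]
  smul_mem' := by
    intro c a ha
    refine ⟨?_, fun n => ?_⟩
    · have : (c • a).2 0 = c • a.2 0 := rfl
      rw [this, ha.1, smul_zero]
    have h : ∀ᵐ x ∂(nMeasure (n + 1)), ∀ i : Fin (n + 1),
        comp (c • a.1) n (x ∘ i.succAbove) = c * comp a.1 n (x ∘ i.succAbove) :=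
      ae_all_iff.2 fun i => (quasiMeasurePreserving_remove i).ae (comp_smul c a.1 n)
    filter_upwards [ha.2 n, comp_smul c a.2 (n + 1), h] with x h1 h3 h4
    simp only [Prod.smul_fst, Prod.smul_snd]
    rw [h3, h1]
    simp only [h4, Finset.mul_sum]
    refine Finset.sum_congr rfl fun i _ => ?_
    ring

theorem creationGraph_functional (f : Mode → ℂ) (z : Fock × Fock) (hz : z ∈ creationGraph f)
    (h0 : z.1 = 0) : z.2 = 0 := by
  refine comp_ext fun n => ?_
  cases n with
  | zero =>
    have h : comp z.2 0 = comp (0 : Fock) 0 := by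
      have := hz.1
      unfold comp
      rw [this]; rfl
    exact Filter.Eventually.of_forall fun x => by rw [h]
  | succ n =>
    have h : ∀ᵐ x ∂(nMeasure (n + 1)), ∀ i : Fin (n + 1),
        comp (0 : Fock) n (x ∘ i.succAbove) = 0 :=
      ae_all_iff.2 fun i => (quasiMeasurePreserving_remove i).ae (comp_zero n)
    filter_upwards [hz.2 n, comp_zero (n + 1), h] with x hx hx0 hx'
    rw [hx, hx0, h0]
    simp [hx']

/-- The creation operator `a(f)*`, on its maximal domain. -/
def creation (f : Mode → ℂ) : Fock →ₗ.[ℂ] Fock := (creationGraph f).toLinearPMap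

theorem creation_graph (f : Mode → ℂ) : (creation f).graph = creationGraph f :=
  Submodule.toLinearPMap_graph_eq _ (creationGraph_functional f)

/-- The annihilation operator `a(f)`, the Hilbert space adjoint of the (densely defined and closed)
creation operator `a(f)*`. -/
def annihilation (f : Mode → ℂ) : Fock →ₗ.[ℂ] Fock := (creation f).adjoint

/-- The Segal field operator `Φ(f)`, the closure of `2^(-1/2) (a(f) + a(f)*)`. -/
def segalField (f : Mode → ℂ) : Fock →ₗ.[ℂ] Fock :=
  (((Real.sqrt 2)⁻¹ : ℂ) • (annihilation f + creation f)).closure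

/-! ### The Dirac polaron Hamiltonian -/

/-- Dirac matrices: Hermitian `4 × 4` matrices `α₁, α₂, α₃, β` with
`αⱼ αₗ + αₗ αⱼ = 2 δⱼₗ`, `αⱼ β + β αⱼ = 0`, `β² = 1`. -/
structure IsDirac (α : Fin 3 → Matrix (Fin 4) (Fin 4) ℂ) (β : Matrix (Fin 4) (Fin 4) ℂ) :
    Prop where
  hermitian_alpha : ∀ j, (α j).IsHermitian
  hermitian_beta : β.IsHermitian
  anticomm_alpha : ∀ j l, α j * α l + α l * α j = if j = l then 2 else 0
  anticomm_beta : ∀ j, α j * β + β * α j = 0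
  sq_beta : β * β = 1

/-- Polarization vectors `e⁽¹⁾, e⁽²⁾ : ℝ³ → ℝ³`: Borel measurable, pointwise orthonormal and
transverse. -/
structure IsPolarization (e : Fin 2 → R3 → R3) : Prop where
  measurable : ∀ l, Measurable (e l)
  orthonormal : ∀ k l r, ⟪e l k, e r k⟫_ℝ = if l = r then 1 else 0
  transverse : ∀ k l, ⟪e l k, k⟫_ℝ = 0

/-- The coupling function `gⱼ(k,λ) = |k|^(-1/2) ρ(k) eⱼ^(λ)(k)` (at position `x = 0`). -/
def coupling (ρ : R3 → ℂ) (e : Fin 2 → R3 → R3) (j : Fin 3) : Mode → ℂ :=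
  fun x => ((‖x.1‖ ^ (-(1 / 2) : ℝ) : ℝ) : ℂ) * ρ x.1 * ((e x.2 x.1 j : ℝ) : ℂ)

/-- The quantized vector potential `Aⱼ = Aⱼ(0)`. -/
def vectorPotential (ρ : R3 → ℂ) (e : Fin 2 → R3 → R3) (j : Fin 3) : Fock →ₗ.[ℂ] Fock :=
  segalField (coupling ρ e j)

/-- The dispersion relation `ω_m(k) = (1 + m)|k| + m`. -/
def omega (m : ℝ) (k : R3) : ℝ := (1 + m) * ‖k‖ + m

/-- The fibre Hilbert space `ℂ⁴ ⊗ Fock`, realised as the Hilbert space of 4-tuples of Fock space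
vectors. -/
abbrev Fibre : Type := PiLp 2 fun _ : Fin 4 => Fock

/-- The operator `C ⊗ B` on `ℂ⁴ ⊗ F`, for a `4 × 4` matrix `C` and an operator `B` on a Hilbert
space `F`: its domain is `ℂ⁴ ⊗ Dom(B)` and `((C ⊗ B) Ψ)ₛ = ∑ₜ Cₛₜ B Ψₜ`. -/
def tensorOp {F : Type*} [NormedAddCommGroup F] [InnerProductSpace ℂ F]
    (C : Matrix (Fin 4) (Fin 4) ℂ) (B : F →ₗ.[ℂ] F) :
    PiLp 2 (fun _ : Fin 4 => F) →ₗ.[ℂ] PiLp 2 (fun _ : Fin 4 => F) where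
  domain :=
    { carrier := {Ψ | ∀ t, Ψ t ∈ B.domain}
      zero_mem' := fun _ => B.domain.zero_mem
      add_mem' := fun ha hb t => B.domain.add_mem (ha t) (hb t)
      smul_mem' := fun c _ ha t => B.domain.smul_mem c (ha t) }
  toFun :=
    { toFun := fun Ψ => WithLp.toLp 2 fun s => ∑ t, C s t • B ⟨Ψ.1 t, Ψ.2 t⟩
      map_add' := by
        intro Ψ Φ
        ext1 s
        simp only [PiLp.add_apply, ← Finset.sum_add_distrib, ← smul_add, ← LinearPMap.map_add]
        rfl
      map_smul' := by
        intro c Ψ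
        ext1 s
        simp only [PiLp.smul_apply, Finset.smul_sum, RingHom.id_apply]
        refine Finset.sum_congr rfl fun t _ => ?_
        rw [smul_comm c]
        exact congrArg (fun y => C s t • y) (LinearPMap.map_smul B c ⟨Ψ.1 t, Ψ.2 t⟩) }

/-- The Hamiltonian
`H_m(p) = α·p + M β + dΓ(ω_m) - α·dΓ(k) - q α·A` on its natural domain. -/
def hamiltonian (α : Fin 3 → Matrix (Fin 4) (Fin 4) ℂ) (β : Matrix (Fin 4) (Fin 4) ℂ)
    (e : Fin 2 → R3 → R3) (ρ : R3 → ℂ) (M q m : ℝ) (p : R3) : Fibre →ₗ.[ℂ] Fibre :=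
  tensorOp (∑ j, ((p j : ℝ) : ℂ) • α j + (M : ℂ) • β) (LinearMap.id.toPMap ⊤)
    + tensorOp 1 (dGamma (omega m))
    - ∑ j, tensorOp (α j) (dGamma fun k => k j)
    - (q : ℂ) • ∑ j, tensorOp (α j) (vectorPotential ρ e j)

/-! ### Spectrum and unitary equivalence -/

section Operators

variable {E : Type*} [NormedAddCommGroup E] [InnerProductSpace ℂ E]

/-- The resolvent set of an unbounded operator `A`: those `z` for which `A - z` is a bijection from
`Dom(A)` onto the whole space with bounded inverse `R`. -/
def resolventSet (A : E →ₗ.[ℂ] E) : Set ℂ :=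
  {z | ∃ R : E →L[ℂ] E,
    (∀ y, ∃ h : R y ∈ A.domain, A ⟨R y, h⟩ - z • R y = y) ∧
    ∀ x : A.domain, R (A x - z • (x : E)) = x}

/-- The spectrum of an unbounded operator. -/
def spectrum (A : E →ₗ.[ℂ] E) : Set ℂ := (resolventSet A)ᶜ

/-- The infimum of the (real) spectrum, in the extended real line. -/
def infSpectrum (A : E →ₗ.[ℂ] E) : EReal :=
  sInf ((fun t : ℝ => (t : EReal)) '' {t : ℝ | (t : ℂ) ∈ spectrum A})

/-- `U A U⁻¹ = B` as unbounded operators (equality of domains included). -/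
def Intertwines (U : E ≃ₗᵢ[ℂ] E) (A B : E →ₗ.[ℂ] E) : Prop :=
  ∀ x y : E, (x, y) ∈ A.graph ↔ (U x, U y) ∈ B.graph

end Operators

/-- The energy `E_m(p) = inf σ(closure of H_m(p))`. -/
def energy (α : Fin 3 → Matrix (Fin 4) (Fin 4) ℂ) (β : Matrix (Fin 4) (Fin 4) ℂ)
    (e : Fin 2 → R3 → R3) (ρ : R3 → ℂ) (M q m : ℝ) (p : R3) : EReal :=
  infSpectrum (hamiltonian α β e ρ M q m p).closure

/-! ### The symmetry -/

/-- The action of a `3 × 3` matrix on `ℝ³`. -/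
def act (T : Matrix (Fin 3) (Fin 3) ℝ) (k : R3) : R3 := WithLp.toLp 2 (T.mulVec k.ofLp)

/-- `u` is a unitary matrix that implements `T` on the Dirac matrices:
`u αⱼ u⁻¹ = ∑ₗ Tₗⱼ αₗ` and `u β u⁻¹ = β`; so `u (α·p) u⁻¹ = α·(T p)`. -/
structure IsDiracIntertwiner (α : Fin 3 → Matrix (Fin 4) (Fin 4) ℂ)
    (β : Matrix (Fin 4) (Fin 4) ℂ) (T : Matrix (Fin 3) (Fin 3) ℝ)
    (u : Matrix (Fin 4) (Fin 4) ℂ) : Prop where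
  unitary : u ∈ Matrix.unitaryGroup (Fin 4) ℂ
  alpha : ∀ j, u * α j * star u = ∑ l, ((T l j : ℝ) : ℂ) • α l
  beta : u * β * star u = β

/-- `W` is the rotation of one-photon states by the orthogonal matrix `T`, followed by a momentum
dependent unitary change of polarization (including phases):
`(W f)(k,λ) = ∑_μ B(k)_{λμ} f(T⁻¹k, μ)`, where `B(k)` is a unitary `2 × 2` matrix depending
measurably on `k`. -/
def IsPhotonRotation (T : Matrix (Fin 3) (Fin 3) ℝ) (W : OnePhoton ≃ₗᵢ[ℂ] OnePhoton) : Prop :=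
  ∃ B : R3 → Matrix (Fin 2) (Fin 2) ℂ,
    (∀ l r, Measurable fun k => B k l r) ∧
    (∀ k, B k ∈ Matrix.unitaryGroup (Fin 2) ℂ) ∧
    ∀ f : OnePhoton, ∀ᵐ x ∂modeMeasure,
      W f x = ∑ r, B x.1 x.2 r * f (act T.transpose x.1, r)

/-- `G = Γ(W)`: the unitary operator `G` of Fock space preserves the number of photons and maps
`f ⊗ ⋯ ⊗ f` to `W f ⊗ ⋯ ⊗ W f`. As the vectors `f ⊗ ⋯ ⊗ f` span a dense subspace of the
`n`-photon space, this determines `G`. -/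
def IsSecondQuantization (W : OnePhoton ≃ₗᵢ[ℂ] OnePhoton) (G : Fock ≃ₗᵢ[ℂ] Fock) : Prop :=
  (∀ n (ψ : Fock), ψ n = 0 → G ψ n = 0) ∧
  ∀ n (f : OnePhoton) (ψ : Fock),
    (∀ᵐ x ∂(nMeasure n), comp ψ n x = ∏ i, f (x i)) →
    ∀ᵐ x ∂(nMeasure n), comp (G ψ) n x = ∏ i, W f (x i)

/-- `U = u ⊗ G` on `ℂ⁴ ⊗ Fock`. -/
def IsTensor (u : Matrix (Fin 4) (Fin 4) ℂ) (G : Fock ≃ₗᵢ[ℂ] Fock) (U : Fibre ≃ₗᵢ[ℂ] Fibre) :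
    Prop :=
  ∀ Ψ s, U Ψ s = ∑ t, u s t • G (Ψ t)

end DiracPolaron

end

noncomputable section

namespace DiracPolaron

/-! ### Unitary equivalence of unbounded operators, closures and spectra -/

section Operators

variable {E : Type*} [NormedAddCommGroup E] [InnerProductSpace ℂ E]

/-! The unitary is built from one factor on spinors and one on photons, so that both rotate by `T`
and the scalar products `α·dΓ(k)` and `α·A` are preserved. Spinors: by Cartan–Dieudonné `T` is a
product of reflections. For a unit vector `n`, conjugation by `α·n` is minus the reflection in the
plane orthogonal to `n` and sends `β` to `-β`; the matrix `α₁α₂α₃β` anticommutes with every `αⱼ` and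
with `β`, and multiplying by it corrects both signs (`exists_isDiracIntertwiner`). Photons: for `k ≠
0` the vectors `T⁻¹e⁽ˡ⁾(k)` and `e⁽ʳ⁾(T⁻¹k)` are two orthonormal bases of the plane orthogonal to
`T⁻¹k`, hence related by an orthogonal `2 × 2` matrix. Multiplying it by the phase `ρ(k)/ρ(T⁻¹k)`
gives a `W` with `W gⱼ = ∑ᵢ Tᵢⱼ gᵢ` (`exists_rotationData`). Second quantization then carries `Aⱼ`
to `∑ᵢ Tᵢⱼ Aᵢ` on a suitable domain, `dΓ(kⱼ)` to `∑ᵢ Tᵢⱼ dΓ(kᵢ)`, and fixes `dΓ(ω_m)` because `ω_m`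
is radial. Contracting with `u αⱼ u⁻¹ = ∑ₗ Tₗⱼ αₗ` and using `T Tᵗ = 1`, only `α·p` changes, into
`α·(Tp)`. The analytic point is the domain: sums of unbounded operators can be rearranged only where
every term is defined. Since `|kⱼ| ≤ ω_m`, and `gⱼ` and `ω_m^(-1/2) gⱼ` are square integrable, the
domain of `dΓ(ω_m)` lies in those of `dΓ(kⱼ)`, `a(gⱼ)*`, `a(gⱼ)` and `Aⱼ` (`dGamma_domain_le`,
`dGamma_domain_le_creation`, `dGamma_domain_le_annihilation`). The natural domain of the Hamiltonian
is therefore that of `dΓ(ω_m)` in each spinor component, and it is invariant under the unitary. All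
identities are checked on graphs there, and then pass to closures and spectra. -/

theorem Intertwines.symm {U : E ≃ₗᵢ[ℂ] E} {A B : E →ₗ.[ℂ] E} (h : Intertwines U A B) :
    Intertwines U.symm B A := fun x y => by
  simpa using (h (U.symm x) (U.symm y)).symm

/-- `U ⊕ U` is continuous, so it maps the closed graph of `A` into the closed graph of `B`, over
which the zero vector has only the value zero. -/
theorem Intertwines.isClosable {U : E ≃ₗᵢ[ℂ] E} {A B : E →ₗ.[ℂ] E} (h : Intertwines U A B)
    (hB : B.IsClosable) : A.IsClosable := by
  obtain ⟨B', hB'⟩ := hB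
  have key : ∀ z ∈ A.graph.topologicalClosure, (U z.1, U z.2) ∈ B'.graph := by
    intro z hz
    rw [← hB']
    exact map_mem_closure (f := fun z : E × E => (U z.1, U z.2)) (by fun_prop) hz
      fun w hw => (h w.1 w.2).1 hw
  refine ⟨A.graph.topologicalClosure.toLinearPMap, ?_⟩
  rw [Submodule.toLinearPMap_graph_eq]
  intro z hz hz0
  have h1 := B'.graph_fst_eq_zero_snd (key z hz) (by rw [hz0, map_zero])
  simpa using h1

theorem Intertwines.closure {U : E ≃ₗᵢ[ℂ] E} {A B : E →ₗ.[ℂ] E} (h : Intertwines U A B) :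
    Intertwines U A.closure B.closure := by
  by_cases hB : B.IsClosable
  · have hA := h.isClosable hB
    intro x y
    rw [← hA.graph_closure_eq_closure_graph, ← hB.graph_closure_eq_closure_graph]
    constructor
    · intro hz
      exact map_mem_closure (f := fun z : E × E => (U z.1, U z.2)) (by fun_prop) hz
        fun w hw => (h w.1 w.2).1 hw
    · intro hz
      have := map_mem_closure (f := fun z : E × E => (U.symm z.1, U.symm z.2)) (by fun_prop) hz
        (t := (A.graph : Set (E × E))) fun w hw => (h.symm w.1 w.2).1 hw
      simp only [LinearIsometryEquiv.symm_apply_apply] at this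
      exact this
  -- The closure of a non-closable operator is by convention the operator itself, and closability is
  -- a unitary invariant, so both sides take the default value together.
  · have hA : ¬ A.IsClosable := fun hA => hB (h.symm.isClosable hA)
    rwa [LinearPMap.closure_def' hA, LinearPMap.closure_def' hB]

/-- In terms of graphs the condition no longer mentions membership proofs, and conjugating `R` by a
unitary becomes a substitution. -/
theorem mem_resolventSet_iff_graph {A : E →ₗ.[ℂ] E} {z : ℂ} :
    z ∈ resolventSet A ↔ ∃ R : E →L[ℂ] E, (∀ y, (R y, y + z • R y) ∈ A.graph) ∧
      ∀ x w, (x, w) ∈ A.graph → R (w - z • x) = x := by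
  refine exists_congr fun R => and_congr (forall_congr' fun y => ?_) ?_
  · simp only [LinearPMap.mem_graph_iff, Subtype.exists, exists_and_left, exists_eq_left,
      sub_eq_iff_eq_add]
  · constructor
    · intro h x w hw
      obtain ⟨a, rfl, rfl⟩ := (LinearPMap.mem_graph_iff A).1 hw
      exact h a
    · intro h x
      exact h x (A x) (A.mem_graph x)

theorem Intertwines.resolventSet_subset {U : E ≃ₗᵢ[ℂ] E} {A B : E →ₗ.[ℂ] E}
    (h : Intertwines U A B) : resolventSet A ⊆ resolventSet B := by
  intro z hz
  obtain ⟨R, h1, h2⟩ := mem_resolventSet_iff_graph.1 hz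
  refine mem_resolventSet_iff_graph.2
    ⟨(U : E →L[ℂ] E) ∘L R ∘L (U.symm : E →L[ℂ] E), fun y => ?_, fun x w hw => ?_⟩
  · simpa using (h _ _).1 (h1 (U.symm y))
  · have := h2 _ _ ((h.symm x w).1 hw)
    simpa [LinearIsometryEquiv.symm_apply_eq] using congrArg U this

theorem Intertwines.infSpectrum_eq {U : E ≃ₗᵢ[ℂ] E} {A B : E →ₗ.[ℂ] E}
    (h : Intertwines U A B) : infSpectrum A = infSpectrum B := by
  have : spectrum A = spectrum B := by
    unfold spectrum
    rw [Set.Subset.antisymm h.resolventSet_subset h.symm.resolventSet_subset]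
  unfold infSpectrum
  rw [this]

end Operators

/-! ### Implementing orthogonal transformations on the Dirac matrices -/

section Dirac

variable {α : Fin 3 → Matrix (Fin 4) (Fin 4) ℂ} {β : Matrix (Fin 4) (Fin 4) ℂ}

theorem IsDiracIntertwiner.one : IsDiracIntertwiner α β 1 1 where
  unitary := one_mem _
  alpha j := by simp [Matrix.one_apply]
  beta := by simp

theorem IsDiracIntertwiner.mul {S T : Matrix (Fin 3) (Fin 3) ℝ} {u v : Matrix (Fin 4) (Fin 4) ℂ}
    (hu : IsDiracIntertwiner α β S u) (hv : IsDiracIntertwiner α β T v) :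
    IsDiracIntertwiner α β (S * T) (u * v) where
  unitary := mul_mem hu.unitary hv.unitary
  alpha j := by
    have : u * v * α j * star (u * v) = u * (v * α j * star v) * star u := by
      simp only [star_mul, mul_assoc]
    rw [this, hv.alpha]
    simp only [Finset.mul_sum, Finset.sum_mul, Matrix.mul_smul, Matrix.smul_mul, hu.alpha,
      Finset.smul_sum, Matrix.mul_apply, Complex.ofReal_sum, Complex.ofReal_mul, Finset.sum_smul,
      smul_smul]
    rw [Finset.sum_comm]
    simp only [mul_comm]
  beta := by
    have : u * v * β * star (u * v) = u * (v * β * star v) * star u := by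
      simp only [star_mul, mul_assoc]
    rw [this, hv.beta, hu.beta]

/-- `α·v` for a real vector `v`. -/
def slash (α : Fin 3 → Matrix (Fin 4) (Fin 4) ℂ) (v : R3) : Matrix (Fin 4) (Fin 4) ℂ :=
  ∑ j, ((v j : ℝ) : ℂ) • α j

theorem slash_anticomm (hD : IsDirac α β) (v w : R3) :
    slash α v * slash α w + slash α w * slash α v = ((2 * ⟪v, w⟫_ℝ : ℝ) : ℂ) • 1 := by
  have h : slash α v * slash α w + slash α w * slash α v
      = ∑ j, ∑ l, ((v j * w l : ℝ) : ℂ) • (α j * α l + α l * α j) := by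
    unfold slash
    simp only [Finset.sum_mul_sum, smul_add, Finset.sum_add_distrib, Matrix.smul_mul,
      Matrix.mul_smul, smul_smul]
    congr 1
    · simp only [Complex.ofReal_mul, mul_comm]
    · rw [Finset.sum_comm]
      simp only [Complex.ofReal_mul]
  rw [h]
  simp only [hD.anticomm_alpha, smul_ite, smul_zero, Finset.sum_ite_eq, Finset.mem_univ, if_true]
  rw [PiLp.inner_apply]
  simp only [← Finset.sum_smul, RCLike.inner_apply, conj_trivial]
  rw [← Complex.ofReal_sum, ← one_add_one_eq_two (R := Matrix (Fin 4) (Fin 4) ℂ), smul_add,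
    ← two_smul ℂ, smul_smul]
  congr 1
  push_cast
  simp only [mul_comm]

theorem slash_single (j : Fin 3) : slash α (EuclideanSpace.single j 1) = α j := by
  simp [slash, PiLp.single_apply]

theorem slash_linear (a b : ℝ) (v w : R3) :
    slash α (a • v + b • w) = (a : ℂ) • slash α v + (b : ℂ) • slash α w := by
  simp only [slash, PiLp.add_apply, PiLp.smul_apply, smul_eq_mul, Complex.ofReal_add,
    Complex.ofReal_mul, add_smul, Finset.sum_add_distrib, Finset.smul_sum, smul_smul]

theorem slash_isHermitian (hD : IsDirac α β) (v : R3) : star (slash α v) = slash α v := by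
  simp only [slash, star_sum, star_smul, Matrix.star_eq_conjTranspose,
    (hD.hermitian_alpha _).eq]
  simp

theorem slash_mul_beta (hD : IsDirac α β) (v : R3) : slash α v * β = -(β * slash α v) := by
  rw [eq_neg_iff_add_eq_zero]
  simp only [slash, Finset.sum_mul, Finset.mul_sum, ← Finset.sum_add_distrib, Matrix.smul_mul,
    Matrix.mul_smul, ← smul_add, hD.anticomm_beta, smul_zero, Finset.sum_const_zero]

/-- The chirality matrix, up to a phase. -/
def chiral (α : Fin 3 → Matrix (Fin 4) (Fin 4) ℂ) (β : Matrix (Fin 4) (Fin 4) ℂ) :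
    Matrix (Fin 4) (Fin 4) ℂ := α 0 * α 1 * α 2 * β

theorem IsDirac.sq_alpha (hD : IsDirac α β) (j : Fin 3) : α j * α j = 1 := by
  have h := hD.anticomm_alpha j j
  rw [if_pos rfl, ← two_mul] at h
  have h2 : (2 : ℂ) • (α j * α j) = (2 : ℂ) • 1 := by
    rw [two_smul, two_smul, ← two_mul, h, one_add_one_eq_two]
  exact smul_right_injective _ two_ne_zero h2

theorem IsDirac.alpha_mul_alpha (hD : IsDirac α β) {j l : Fin 3} (h : j ≠ l) :
    α j * α l = -(α l * α j) := by
  have := hD.anticomm_alpha j l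
  rw [if_neg h] at this
  exact eq_neg_of_add_eq_zero_left this

theorem IsDirac.alpha_mul_beta (hD : IsDirac α β) (j : Fin 3) : α j * β = -(β * α j) :=
  eq_neg_of_add_eq_zero_left (hD.anticomm_beta j)

/-- A factor moved through the product passes the three others with a sign each and itself with
none, so the total sign is odd. -/
theorem anticomm_prod_four {R : Type*} [Ring R] {a b c d : R} (hab : a * b = -(b * a))
    (hac : a * c = -(c * a)) (had : a * d = -(d * a)) (hbc : b * c = -(c * b))
    (hbd : b * d = -(d * b)) (hcd : c * d = -(d * c)) :
    a * b * c * d * a = -(a * (a * b * c * d)) ∧ a * b * c * d * b = -(b * (a * b * c * d)) ∧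
    a * b * c * d * c = -(c * (a * b * c * d)) ∧ a * b * c * d * d = -(d * (a * b * c * d)) := by
  have swap {x y : R} (h : x * y = -(y * x)) (z : R) : y * (x * z) = -(x * (y * z)) := by
    rw [← mul_assoc, ← mul_assoc, h, neg_mul, neg_neg]
  have swap' {x y : R} (h : x * y = -(y * x)) : y * x = -(x * y) := by rw [h, neg_neg]
  refine ⟨?_, ?_, ?_, ?_⟩ <;>
  simp only [mul_assoc, swap hab, swap hac, swap had, swap hbc, swap hbd, swap hcd, swap' had,
    swap' hbd, swap' hcd, mul_neg, neg_neg]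

theorem chiral_mul_alpha_and_beta (hD : IsDirac α β) :
    (∀ j, chiral α β * α j = -(α j * chiral α β)) ∧ chiral α β * β = -(β * chiral α β) := by
  obtain ⟨h0, h1, h2, h3⟩ := anticomm_prod_four
    (hD.alpha_mul_alpha (j := 0) (l := 1) (by decide))
    (hD.alpha_mul_alpha (j := 0) (l := 2) (by decide)) (hD.alpha_mul_beta 0)
    (hD.alpha_mul_alpha (j := 1) (l := 2) (by decide)) (hD.alpha_mul_beta 1) (hD.alpha_mul_beta 2)
  exact ⟨fun j => by fin_cases j <;> assumption, h3⟩

theorem chiral_mul_star (hD : IsDirac α β) : chiral α β * star (chiral α β) = 1 := by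
  have h0 := hD.sq_alpha 0
  have h1 := hD.sq_alpha 1
  have h2 := hD.sq_alpha 2
  have hb := hD.sq_beta
  have e : star (chiral α β) = β * (α 2 * (α 1 * α 0)) := by
    simp only [chiral, star_mul, Matrix.star_eq_conjTranspose, (hD.hermitian_alpha _).eq,
      hD.hermitian_beta.eq]
  rw [e]
  unfold chiral
  grind

theorem chiral_mul_slash (hD : IsDirac α β) (v : R3) :
    chiral α β * slash α v = -(slash α v * chiral α β) := by
  simp only [slash, Finset.mul_sum, Finset.sum_mul, Matrix.mul_smul, Matrix.smul_mul,
    (chiral_mul_alpha_and_beta hD).1, smul_neg, Finset.sum_neg_distrib]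

/-- The matrix of a linear isometry of `ℝ³` in the standard basis. -/
def isometryMatrix (φ : R3 ≃ₗᵢ[ℝ] R3) : Matrix (Fin 3) (Fin 3) ℝ :=
  fun l j => φ (EuclideanSpace.single j 1) l

theorem isometryMatrix_one : isometryMatrix 1 = 1 := by
  ext l j
  simp [isometryMatrix, Matrix.one_apply]

theorem isometryMatrix_mul (φ ψ : R3 ≃ₗᵢ[ℝ] R3) :
    isometryMatrix (φ * ψ) = isometryMatrix φ * isometryMatrix ψ := by
  ext l j
  have h : ψ (EuclideanSpace.single j 1)
      = ∑ i, (ψ (EuclideanSpace.single j 1) i) • EuclideanSpace.single i (1 : ℝ) := by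
    ext i
    simp [Pi.single_apply]
  change φ (ψ (EuclideanSpace.single j 1)) l = _
  rw [h, map_sum, Matrix.mul_apply]
  simp [isometryMatrix, mul_comm]

theorem sum_isometryMatrix_smul (φ : R3 ≃ₗᵢ[ℝ] R3) (j : Fin 3) :
    ∑ l, ((isometryMatrix φ l j : ℝ) : ℂ) • α l = slash α (φ (EuclideanSpace.single j 1)) := rfl

/-- Conjugation by `α·n` fixes `α·n` and negates both `β` and `α·v` for `v` orthogonal to `n`. This
is minus the wanted action, and conjugation by the chirality matrix supplies the missing sign. -/
theorem isDiracIntertwiner_reflection (hD : IsDirac α β) (n : R3) (hn : ‖n‖ = 1) :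
    IsDiracIntertwiner α β (isometryMatrix (ℝ ∙ n)ᗮ.reflection) (chiral α β * slash α n) := by
  have hs := slash_isHermitian hD n
  have hc := chiral_mul_star hD
  have hss : slash α n * slash α n = 1 := by
    have h := slash_anticomm hD n n
    rw [real_inner_self_eq_norm_sq, hn, ← two_smul ℂ] at h
    exact smul_right_injective _ (two_ne_zero (α := ℂ)) (by simpa using h)
  refine ⟨?_, fun j => ?_, ?_⟩
  · rw [Matrix.mem_unitaryGroup_iff, star_mul, hs, mul_assoc, ← mul_assoc (slash α n), hss,
      one_mul, hc]
  · have h1 := slash_anticomm hD n (EuclideanSpace.single j 1)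
    have h2 := (chiral_mul_alpha_and_beta hD).1 j
    have h3 := chiral_mul_slash hD n
    rw [slash_single] at h1
    have hr : (ℝ ∙ n)ᗮ.reflection (EuclideanSpace.single j 1)
        = (1 : ℝ) • EuclideanSpace.single j (1 : ℝ)
          + (-(2 * ⟪n, EuclideanSpace.single j 1⟫_ℝ)) • n := by
      rw [Submodule.reflection_orthogonal_apply, Submodule.reflection_singleton_apply, hn]
      simp only [RCLike.ofReal_real_eq_id, id_eq, one_pow, div_one, neg_sub, one_smul, neg_smul,
        mul_smul, two_smul ℝ, two_smul ℕ]
      abel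
    rw [sum_isometryMatrix_smul, hr, slash_linear, slash_single, star_mul, hs]
    generalize ⟪n, EuclideanSpace.single j (1 : ℝ)⟫_ℝ = r at *
    -- Up to sign, the right-hand side is `α·v` for the reflected basis vector `v`.
    have h4 : slash α n * α j * slash α n = ((2 * r : ℝ) : ℂ) • slash α n - α j := by
      rw [eq_sub_of_add_eq h1, sub_mul, mul_assoc, hss]
      simp
    calc chiral α β * slash α n * α j * (slash α n * star (chiral α β))
        = chiral α β * (slash α n * α j * slash α n) * star (chiral α β) := by
          simp only [mul_assoc]
      _ = -(((2 * r : ℝ) : ℂ) • slash α n - α j) * (chiral α β * star (chiral α β)) := by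
          rw [h4, mul_sub, Matrix.mul_smul, h3, h2, ← mul_assoc]
          simp only [neg_sub, sub_mul, Matrix.smul_mul, smul_neg, Matrix.neg_mul]
          abel
      _ = _ := by
          rw [hc]
          simp only [mul_one, Complex.ofReal_neg, Complex.ofReal_one, one_smul, neg_smul]
          abel
  · have h2 := (chiral_mul_alpha_and_beta hD).2
    have h3 := slash_mul_beta hD n
    rw [star_mul, hs]
    calc chiral α β * slash α n * β * (slash α n * star (chiral α β))
        = chiral α β * (slash α n * β) * slash α n * star (chiral α β) := by
          simp only [mul_assoc]
      _ = -(chiral α β * β * (slash α n * slash α n)  * star (chiral α β)) := by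
          rw [h3]; simp only [mul_neg, neg_mul, mul_assoc]
      _ = β * (chiral α β * star (chiral α β)) := by
          rw [hss, h2]; simp only [mul_one, neg_mul, neg_neg, mul_assoc]
      _ = β := by rw [hc, mul_one]

/-- Cartan–Dieudonné reduces to reflections, and intertwiners multiply. -/
theorem exists_isDiracIntertwiner (hD : IsDirac α β) (φ : R3 ≃ₗᵢ[ℝ] R3) :
    ∃ u, IsDiracIntertwiner α β (isometryMatrix φ) u := by
  obtain ⟨l, -, rfl⟩ := φ.reflections_generate_dim
  induction l with
  | nil => exact ⟨1, by simpa only [List.map_nil, List.prod_nil, isometryMatrix_one] using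
      IsDiracIntertwiner.one⟩
  | cons v l ih =>
    obtain ⟨u, hu⟩ := ih
    rw [List.map_cons, List.prod_cons, isometryMatrix_mul]
    -- The list of reflection vectors may contain zero, whose reflection is the identity; the others
    -- are normalized, which does not change the line they span.
    by_cases hv : v = 0
    · refine ⟨1 * u, IsDiracIntertwiner.mul ?_ hu⟩
      have : (ℝ ∙ v)ᗮ.reflection = 1 := by
        ext1 x
        rw [Submodule.reflection_orthogonal_apply, Submodule.reflection_singleton_apply, hv]
        simp
      rw [this, isometryMatrix_one]
      exact IsDiracIntertwiner.one
    · have hv' : (ℝ ∙ ((‖v‖⁻¹ : ℝ) • v))ᗮ.reflection = (ℝ ∙ v)ᗮ.reflection := by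
        simp only [Submodule.span_singleton_smul_eq (show IsUnit ‖v‖⁻¹ by simpa using hv) v]
      have hn := isDiracIntertwiner_reflection hD ((‖v‖⁻¹ : ℝ) • v)
        (norm_smul_inv_norm (𝕜 := ℝ) hv)
      rw [hv'] at hn
      exact ⟨_, hn.mul hu⟩

end Dirac

/-! ### Orthogonal matrices acting on momentum space -/

section Act

variable {T : Matrix (Fin 3) (Fin 3) ℝ}

theorem act_apply (T : Matrix (Fin 3) (Fin 3) ℝ) (k : R3) (l : Fin 3) :
    act T k l = ∑ j, T l j * k j := rfl

theorem act_mul (S T : Matrix (Fin 3) (Fin 3) ℝ) (k : R3) : act (S * T) k = act S (act T k) := by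
  simp [act, Matrix.mulVec_mulVec]

theorem act_one (k : R3) : act 1 k = k := by simp [act]

theorem transpose_mem_orthogonalGroup (hT : T ∈ Matrix.orthogonalGroup (Fin 3) ℝ) :
    T.transpose ∈ Matrix.orthogonalGroup (Fin 3) ℝ := by
  rw [Matrix.mem_orthogonalGroup_iff']
  simpa [Matrix.star_eq_conjTranspose, Matrix.conjTranspose] using
    (Matrix.mem_orthogonalGroup_iff (Fin 3) ℝ).1 hT

theorem transpose_mul_self (hT : T ∈ Matrix.orthogonalGroup (Fin 3) ℝ) : T.transpose * T = 1 := by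
  simpa [Matrix.star_eq_conjTranspose, Matrix.conjTranspose] using
    (Matrix.mem_orthogonalGroup_iff' (Fin 3) ℝ).1 hT

theorem mul_transpose_self (hT : T ∈ Matrix.orthogonalGroup (Fin 3) ℝ) : T * T.transpose = 1 := by
  simpa [Matrix.star_eq_conjTranspose, Matrix.conjTranspose] using
    (Matrix.mem_orthogonalGroup_iff (Fin 3) ℝ).1 hT

theorem inner_act_left (T : Matrix (Fin 3) (Fin 3) ℝ) (v w : R3) :
    ⟪act T v, w⟫_ℝ = ⟪v, act T.transpose w⟫_ℝ := by
  simp only [PiLp.inner_apply, act_apply, RCLike.inner_apply, conj_trivial, Finset.mul_sum,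
    Finset.sum_mul, Matrix.transpose_apply]
  rw [Finset.sum_comm]
  exact Finset.sum_congr rfl fun i _ => Finset.sum_congr rfl fun j _ => by ring

theorem norm_act (hT : T ∈ Matrix.orthogonalGroup (Fin 3) ℝ) (v : R3) : ‖act T v‖ = ‖v‖ := by
  have h : ⟪act T v, act T v⟫_ℝ = ⟪v, v⟫_ℝ := by
    rw [inner_act_left, ← act_mul, transpose_mul_self hT, act_one]
  rw [real_inner_self_eq_norm_sq, real_inner_self_eq_norm_sq] at h
  exact (sq_eq_sq₀ (norm_nonneg _) (norm_nonneg _)).1 h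

/-- The action of an orthogonal matrix as a linear isometry. -/
def actIsometry (T : Matrix (Fin 3) (Fin 3) ℝ) (hT : T ∈ Matrix.orthogonalGroup (Fin 3) ℝ) :
    R3 ≃ₗᵢ[ℝ] R3 where
  toFun := act T
  invFun := act T.transpose
  map_add' v w := by ext l; simp [act_apply, mul_add, Finset.sum_add_distrib]
  map_smul' c v := by
    ext l
    simp only [act_apply, PiLp.smul_apply, smul_eq_mul, RingHom.id_apply, Finset.mul_sum]
    exact Finset.sum_congr rfl fun j _ => by ring
  left_inv v := by rw [← act_mul, transpose_mul_self hT, act_one]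
  right_inv v := by rw [← act_mul, mul_transpose_self hT, act_one]
  norm_map' := norm_act hT

theorem measurePreserving_act (hT : T ∈ Matrix.orthogonalGroup (Fin 3) ℝ) :
    MeasurePreserving (act T) volume volume :=
  (actIsometry T hT).measurePreserving

theorem isometryMatrix_actIsometry (hT : T ∈ Matrix.orthogonalGroup (Fin 3) ℝ) :
    isometryMatrix (actIsometry T hT) = T := by
  ext l j
  change act T (EuclideanSpace.single j 1) l = T l j
  simp [act_apply, PiLp.single_apply]

end Act

/-! ### Square norms as extended nonnegative integrals -/

section SquareIntegrals

variable {X : Type*} [MeasurableSpace X] {μ : Measure X}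

open ENNReal in
theorem eLpNorm_two_sq (F : X → ℂ) : eLpNorm F 2 μ ^ 2 = ∫⁻ x, ‖F x‖ₑ ^ 2 ∂μ := by
  simpa using eLpNorm_nnreal_pow_eq_lintegral (f := F) (μ := μ) (p := 2) two_ne_zero

theorem memLp_two_iff_lintegral {F : X → ℂ} (hF : AEStronglyMeasurable F μ) :
    MemLp F 2 μ ↔ ∫⁻ x, ‖F x‖ₑ ^ 2 ∂μ < ⊤ := by
  rw [← eLpNorm_two_sq, ENNReal.pow_lt_top_iff]
  simp [MemLp, hF]

theorem Lp_enorm_sq (F : Lp ℂ 2 μ) : ‖F‖ₑ ^ 2 = ∫⁻ x, ‖F x‖ₑ ^ 2 ∂μ := by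
  rw [Lp.enorm_def, eLpNorm_two_sq]

theorem ofReal_norm_sq {E : Type*} [SeminormedAddCommGroup E] (a : E) :
    ENNReal.ofReal (‖a‖ ^ 2) = ‖a‖ₑ ^ 2 := by
  rw [ENNReal.ofReal_pow (norm_nonneg _), ofReal_norm]

end SquareIntegrals

/-! ### Fock space vectors as sequences of symmetric functions -/

theorem fock_enorm_sq (ψ : Fock) : ‖ψ‖ₑ ^ 2 = ∑' n, ∫⁻ x, ‖comp ψ n x‖ₑ ^ 2 ∂nMeasure n := by
  have h := lp.hasSum_norm (p := 2) (by simp) ψ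
  have h2 : ‖ψ‖ ^ 2 = ∑' n, ‖ψ n‖ ^ 2 := by simpa using h.tsum_eq.symm
  have hs : Summable fun n => ‖ψ n‖ ^ 2 := by simpa using h.summable
  rw [← ofReal_norm_sq, h2, ENNReal.ofReal_tsum_of_nonneg (fun _ => sq_nonneg _) hs]
  refine tsum_congr fun n => ?_
  rw [ofReal_norm_sq]
  exact Lp_enorm_sq (ψ n : Lp ℂ 2 (nMeasure n))

theorem fock_lintegral_ne_top (ψ : Fock) : ∑' n, ∫⁻ x, ‖comp ψ n x‖ₑ ^ 2 ∂nMeasure n ≠ ⊤ := by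
  rw [← fock_enorm_sq]
  exact ENNReal.pow_ne_top enorm_ne_top

theorem aestronglyMeasurable_comp (ψ : Fock) (n : ℕ) :
    AEStronglyMeasurable (comp ψ n) (nMeasure n) :=
  Lp.aestronglyMeasurable (ψ n : Lp ℂ 2 (nMeasure n))

theorem comp_perm (ψ : Fock) {n : ℕ} (σ : Equiv.Perm (Fin n)) :
    ∀ᵐ x ∂nMeasure n, comp ψ n (x ∘ σ) = comp ψ n x :=
  (mem_Sector_iff _).1 (ψ n).2 σ

/-- A sequence of symmetric functions with summable squared norms defines a Fock space vector. -/
theorem exists_fock {F : ∀ n, (Fin n → Mode) → ℂ}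
    (hF : ∀ n, AEStronglyMeasurable (F n) (nMeasure n))
    (hsymm : ∀ n (σ : Equiv.Perm (Fin n)), ∀ᵐ x ∂nMeasure n, F n (x ∘ σ) = F n x)
    (hfin : ∑' n, ∫⁻ x, ‖F n x‖ₑ ^ 2 ∂nMeasure n ≠ ⊤) :
    ∃ φ : Fock, ∀ n, ∀ᵐ x ∂nMeasure n, comp φ n x = F n x := by
  have hmem : ∀ n, MemLp (F n) 2 (nMeasure n) := fun n =>
    (memLp_two_iff_lintegral (hF n)).2 (ENNReal.ne_top_of_tsum_ne_top hfin n).lt_top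
  have hsec : ∀ n, (hmem n).toLp ∈ Sector n := by
    intro n
    rw [mem_Sector_iff]
    intro σ
    have h := (hmem n).coeFn_toLp
    filter_upwards [h, (measurePreserving_perm σ).quasiMeasurePreserving.ae h, hsymm n σ]
      with x h1 h2 h3
    rw [h1, h2, h3]
  let φ : ∀ n, Sector n := fun n => ⟨(hmem n).toLp, hsec n⟩
  have hφ : ∀ n, ‖φ n‖ ^ 2 = (∫⁻ x, ‖F n x‖ₑ ^ 2 ∂nMeasure n).toReal := by
    intro n
    have h1 : ‖φ n‖ₑ ^ 2 = ∫⁻ x, ‖F n x‖ₑ ^ 2 ∂nMeasure n := by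
      refine (Lp_enorm_sq ((hmem n).toLp)).trans (lintegral_congr_ae ?_)
      filter_upwards [(hmem n).coeFn_toLp] with x hx
      rw [hx]
    rw [← h1]
    simp
  have hφ' : Memℓp φ 2 := by
    refine memℓp_gen ?_
    have : Summable fun n => ‖φ n‖ ^ 2 := by
      simpa only [hφ] using ENNReal.summable_toReal hfin
    simpa using this
  exact ⟨⟨φ, hφ'⟩, fun n => (hmem n).coeFn_toLp⟩

/-! ### Domains of second quantized multiplication operators -/

theorem mem_dGamma_graph {h : R3 → ℝ} {ψ φ : Fock} :
    (ψ, φ) ∈ (dGamma h).graph ↔ ∀ n, ∀ᵐ x ∂nMeasure n,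
      comp φ n x = ((∑ i, h (x i).1 : ℝ) : ℂ) * comp ψ n x := by
  rw [dGamma_graph]; rfl

theorem mem_creation_graph {f : Mode → ℂ} {ψ φ : Fock} :
    (ψ, φ) ∈ (creation f).graph ↔ φ 0 = 0 ∧ ∀ n, ∀ᵐ x ∂nMeasure (n + 1),
      comp φ (n + 1) x = ((Real.sqrt (n + 1))⁻¹ : ℝ) *
        ∑ i : Fin (n + 1), f (x i) * comp ψ n (x ∘ i.succAbove) := by
  rw [creation_graph]; rfl

theorem quasiMeasurePreserving_coord {n : ℕ} (i : Fin n) :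
    Measure.QuasiMeasurePreserving (fun x : Fin n → Mode => x i) (nMeasure n) modeMeasure :=
  Measure.quasiMeasurePreserving_eval (fun _ => modeMeasure) i

theorem ae_modeMeasure_of_ae {P : R3 → Prop} (h : ∀ᵐ k : R3, P k) :
    ∀ᵐ x ∂modeMeasure, P x.1 :=
  Measure.quasiMeasurePreserving_fst.ae h

theorem ae_nMeasure_of_ae {P : Mode → Prop} (h : ∀ᵐ k ∂modeMeasure, P k) (n : ℕ) :
    ∀ᵐ x ∂nMeasure n, ∀ i, P (x i) :=
  ae_all_iff.2 fun i => (quasiMeasurePreserving_coord i).ae h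

theorem measurable_sum_coord {h : R3 → ℝ} (hh : Measurable h) (n : ℕ) :
    Measurable fun x : Fin n → Mode => ∑ i, h (x i).1 :=
  Finset.measurable_sum _ fun i _ => hh.comp (measurable_fst.comp (measurable_pi_apply i))

theorem sum_coord_perm (h : R3 → ℝ) {n : ℕ} (σ : Equiv.Perm (Fin n)) (x : Fin n → Mode) :
    ∑ i, h ((x ∘ σ) i).1 = ∑ i, h (x i).1 :=
  Equiv.sum_comp σ fun i => h (x i).1

theorem dGamma_domain_le {h h' : R3 → ℝ} (hm : Measurable h') (hle : ∀ k, |h' k| ≤ h k)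
    {ψ : Fock} (hψ : ψ ∈ (dGamma h).domain) : ψ ∈ (dGamma h').domain := by
  obtain ⟨φ, hφ⟩ := LinearPMap.mem_domain_iff.1 hψ
  rw [mem_dGamma_graph] at hφ
  obtain ⟨χ, hχ⟩ := exists_fock (F := fun n x => ((∑ i, h' (x i).1 : ℝ) : ℂ) * comp ψ n x)
    (fun n => (Complex.measurable_ofReal.comp
      (measurable_sum_coord hm n)).aestronglyMeasurable.mul (aestronglyMeasurable_comp ψ n))
    (fun n σ => by
      filter_upwards [comp_perm ψ σ] with x hx
      rw [hx, sum_coord_perm])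
    (ne_top_of_le_ne_top (fock_lintegral_ne_top φ) (ENNReal.tsum_le_tsum fun n => by
      refine lintegral_mono_ae ?_
      filter_upwards [hφ n] with x hx
      rw [hx, enorm_mul, enorm_mul]
      gcongr
      rw [← ofReal_norm, ← ofReal_norm]
      refine ENNReal.ofReal_le_ofReal ?_
      rw [Complex.norm_real, Complex.norm_real, Real.norm_eq_abs, Real.norm_eq_abs]
      calc |∑ i, h' (x i).1| ≤ ∑ i, |h' (x i).1| := Finset.abs_sum_le_sum_abs _ _
        _ ≤ ∑ i, h (x i).1 := Finset.sum_le_sum fun i _ => hle _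
        _ ≤ _ := le_abs_self _))
  exact LinearPMap.mem_domain_iff.2 ⟨χ, mem_dGamma_graph.2 hχ⟩

/-- `dΓ(1)` is the number operator, which multiplies the `n`-photon sector by `n`. -/
theorem single_mem_dGamma_one (n : ℕ) (φ : Sector n) :
    (lp.single 2 n φ : Fock) ∈ (dGamma fun _ => 1).domain := by
  refine LinearPMap.mem_domain_iff.2 ⟨(n : ℂ) • lp.single 2 n φ, mem_dGamma_graph.2 fun m => ?_⟩
  by_cases hm : m = n
  · subst hm
    filter_upwards [comp_smul (m : ℂ) (lp.single 2 m φ) m] with x hx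
    rw [hx]
    simp
  · have h0 : (lp.single 2 n φ : Fock) m = 0 := 
      lp.single_apply_ne (E := fun n : ℕ => Sector n) 2 n φ hm
    have h1 : ∀ᵐ x ∂nMeasure m, comp (lp.single 2 n φ) m x = 0 := by
      have := comp_zero m
      unfold comp at this ⊢
      rwa [h0]
    filter_upwards [comp_smul (n : ℂ) (lp.single 2 n φ) m, h1] with x hx hx1
    rw [hx, hx1]
    simp

theorem dense_dGamma_one : Dense ((dGamma fun _ => 1).domain : Set Fock) := by
  intro ψ
  refine mem_closure_of_tendsto (lp.hasSum_single (by simp) ψ)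
    (Filter.Eventually.of_forall fun s => ?_)
  exact Submodule.sum_mem _ fun n _ => single_mem_dGamma_one n (ψ n)

/-! ### Domains of creation operators -/

theorem exists_perm_succAbove {n : ℕ} (σ : Equiv.Perm (Fin (n + 1))) (i : Fin (n + 1)) :
    ∃ τ : Equiv.Perm (Fin n), ∀ j, σ (i.succAbove j) = (σ i).succAbove (τ j) := by
  have h : ∀ j, ∃ l, (σ i).succAbove l = σ (i.succAbove j) := fun j =>
    Fin.exists_succAbove_eq fun hj => Fin.succAbove_ne i j (σ.injective hj)
  choose t ht using h
  have hinj : Function.Injective t := fun a b hab => by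
    have := (ht a).symm.trans ((congrArg _ hab).trans (ht b))
    exact Fin.succAbove_right_injective (σ.injective this)
  exact ⟨Equiv.ofBijective t (Finite.injective_iff_bijective.1 hinj), fun j => (ht j).symm⟩

/-- Permuting the arguments permutes the summands. What remains in each summand is a permutation of
the other `n` arguments, absorbed by the symmetry of `ψ`. -/
theorem creation_symm (f : Mode → ℂ) (ψ : Fock) {n : ℕ} (σ : Equiv.Perm (Fin (n + 1))) :
    ∀ᵐ x ∂nMeasure (n + 1),
      ∑ i : Fin (n + 1), f ((x ∘ σ) i) * comp ψ n ((x ∘ σ) ∘ i.succAbove)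
        = ∑ i : Fin (n + 1), f (x i) * comp ψ n (x ∘ i.succAbove) := by
  choose τ hτ using fun i => exists_perm_succAbove σ i
  have h : ∀ᵐ x ∂nMeasure (n + 1), ∀ i : Fin (n + 1),
      comp ψ n ((x ∘ (σ i).succAbove) ∘ τ i) = comp ψ n (x ∘ (σ i).succAbove) :=
    ae_all_iff.2 fun i => (quasiMeasurePreserving_remove (σ i)).ae (comp_perm ψ (τ i))
  filter_upwards [h] with x hx
  rw [← Equiv.sum_comp σ fun i => f (x i) * comp ψ n (x ∘ i.succAbove)]
  refine Finset.sum_congr rfl fun i _ => ?_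
  rw [← hx i]
  congr 2
  funext j
  simp [hτ]

/-- Coupling functions that are admissible for the weight `h`: `f` and `h^(-1/2) f` are square
integrable. -/
structure Admissible (h : R3 → ℝ) (f : Mode → ℂ) : Prop where
  measurable_weight : Measurable h
  weight_pos : ∀ᵐ k : R3, 0 < h k
  memLp : MemLp f 2 modeMeasure
  memLp_div : MemLp (fun x => ((Real.sqrt (h x.1))⁻¹ : ℝ) * f x) 2 modeMeasure

/-- With weight `1` the domain estimates concern the number operator and need only `f` in `L²`. They
yield the dense common domain used to test adjoints. -/
theorem admissible_one {f : Mode → ℂ} (hf : MemLp f 2 modeMeasure) :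
    Admissible (fun _ => 1) f :=
  ⟨measurable_const, by simp, hf, by simpa using hf⟩

/-- Cauchy–Schwarz with weights `wᵢ`, after which the total weight is split, in the `i`-th term,
into `wᵢ` and the sum over the other indices. -/
theorem sum_sq_le_weighted {n : ℕ} (a : Fin (n + 1) → ℝ) {w : Fin (n + 1) → ℝ}
    (hw : ∀ i, 0 < w i) :
    (∑ i, a i) ^ 2 ≤ ∑ i, (a i ^ 2 + (a i ^ 2 / w i) * ∑ j, w (i.succAbove j)) := by
  have h := Finset.sum_sq_le_sum_mul_sum_of_sq_le_mul Finset.univ (r := a) (f := w)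
    (g := fun i => a i ^ 2 / w i) (fun i _ => (hw i).le)
    (fun i _ => div_nonneg (sq_nonneg _) (hw i).le)
    (fun i _ => (mul_div_cancel₀ _ (hw i).ne').ge)
  refine h.trans (le_of_eq ?_)
  rw [Finset.mul_sum]
  refine Finset.sum_congr rfl fun i _ => ?_
  rw [Fin.sum_univ_succAbove w i, add_mul, mul_div_cancel₀ _ (hw i).ne', mul_comm (∑ j, _)]

theorem lintegral_removeNth {n : ℕ} (i : Fin (n + 1)) {A : Mode → ENNReal}
    {B : (Fin n → Mode) → ENNReal} (hA : AEMeasurable A modeMeasure)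
    (hB : AEMeasurable B (nMeasure n)) :
    ∫⁻ x, A (x i) * B (x ∘ i.succAbove) ∂nMeasure (n + 1)
      = (∫⁻ y, A y ∂modeMeasure) * ∫⁻ z, B z ∂nMeasure n := by
  rw [← lintegral_prod_mul hA hB]
  exact (measurePreserving_piFinSuccAbove (fun _ : Fin (n + 1) => modeMeasure) i).lintegral_comp_emb
    (MeasurableEquiv.measurableEmbedding _) (fun z => A z.1 * B z.2)

theorem aestronglyMeasurable_creation {f : Mode → ℂ} (hf : AEStronglyMeasurable f modeMeasure)
    (ψ : Fock) (n : ℕ) :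
    AEStronglyMeasurable (fun x : Fin (n + 1) → Mode => (((Real.sqrt (n + 1))⁻¹ : ℝ) : ℂ) *
      ∑ i : Fin (n + 1), f (x i) * comp ψ n (x ∘ i.succAbove)) (nMeasure (n + 1)) := by
  refine AEStronglyMeasurable.const_mul ?_ _
  refine Finset.aestronglyMeasurable_fun_sum _ fun i _ => ?_
  exact (hf.comp_quasiMeasurePreserving (quasiMeasurePreserving_coord i)).mul
    ((aestronglyMeasurable_comp ψ n).comp_quasiMeasurePreserving (quasiMeasurePreserving_remove i))

/-- The quadratic form of `dΓ(h)` on the `n`-photon component. -/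
def weightInt (h : R3 → ℝ) (ψ : Fock) (n : ℕ) : ENNReal :=
  ∫⁻ x, ENNReal.ofReal (∑ i, h (x i).1) * ‖comp ψ n x‖ₑ ^ 2 ∂nMeasure n

/-- Pointwise `s ≤ 1 + s²`, so the quadratic form is bounded by `‖ψ‖² + ‖dΓ(h)ψ‖²`. Negative `s` are
truncated to zero, so no sign condition on `h` is needed. -/
theorem tsum_weightInt_ne_top {h : R3 → ℝ} {ψ : Fock} (hψ : ψ ∈ (dGamma h).domain) :
    ∑' n, weightInt h ψ n ≠ ⊤ := by
  obtain ⟨φ, hφ⟩ := LinearPMap.mem_domain_iff.1 hψ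
  rw [mem_dGamma_graph] at hφ
  refine ne_top_of_le_ne_top
    (ENNReal.add_ne_top.2 ⟨fock_lintegral_ne_top ψ, fock_lintegral_ne_top φ⟩) ?_
  rw [← ENNReal.tsum_add]
  refine ENNReal.tsum_le_tsum fun n => ?_
  rw [← lintegral_add_left' ((aestronglyMeasurable_comp ψ n).enorm.pow_const 2)]
  refine lintegral_mono_ae ?_
  filter_upwards [hφ n] with x hx
  rw [hx]
  simp only [← ofReal_norm_sq]
  by_cases hs : 0 ≤ ∑ i, h (x i).1
  · rw [← ENNReal.ofReal_mul hs, ← ENNReal.ofReal_add (sq_nonneg _) (sq_nonneg _)]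
    refine ENNReal.ofReal_le_ofReal ?_
    rw [norm_mul, Complex.norm_real, Real.norm_eq_abs, mul_pow, sq_abs]
    nlinarith [sq_nonneg ‖comp ψ n x‖, sq_nonneg (∑ i, h (x i).1 - 1),
      mul_nonneg (sq_nonneg ‖comp ψ n x‖) (sq_nonneg (∑ i, h (x i).1 - 1)),
      mul_nonneg (sq_nonneg ‖comp ψ n x‖) hs]
  · rw [ENNReal.ofReal_of_nonpos (not_le.1 hs).le, zero_mul]
    exact bot_le

theorem norm_sq_div_weight {w : ℝ} (hw : 0 < w) (z : ℂ) :
    ‖(((Real.sqrt w)⁻¹ : ℝ) : ℂ) * z‖ ^ 2 = ‖z‖ ^ 2 / w := by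
  rw [norm_mul, Complex.norm_real, Real.norm_eq_abs, mul_pow, sq_abs, inv_pow,
    Real.sq_sqrt hw.le, inv_mul_eq_div]

/-- The standard bound `‖a(f)*ψ‖² ≤ ‖f‖²‖ψ‖² + ‖h^(-1/2)f‖²⟨ψ, dΓ(h)ψ⟩`, sector by sector. It is
`sum_sq_le_weighted` with weights `h(xᵢ)`: in the `i`-th term the variable `xᵢ` separates from the
others, and the `n + 1` equal integrals cancel the normalization. -/
theorem creation_lintegral_le {h : R3 → ℝ} {f : Mode → ℂ} (hf : Admissible h f) (ψ : Fock)
    (n : ℕ) :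
    ∫⁻ x, ‖(((Real.sqrt (n + 1))⁻¹ : ℝ) : ℂ) *
      ∑ i : Fin (n + 1), f (x i) * comp ψ n (x ∘ i.succAbove)‖ₑ ^ 2 ∂nMeasure (n + 1)
      ≤ (∫⁻ y, ‖f y‖ₑ ^ 2 ∂modeMeasure) * (∫⁻ z, ‖comp ψ n z‖ₑ ^ 2 ∂nMeasure n)
        + (∫⁻ y, ‖(((Real.sqrt (h y.1))⁻¹ : ℝ) : ℂ) * f y‖ₑ ^ 2 ∂modeMeasure)
          * weightInt h ψ n := by
  set g : Mode → ℂ := fun y => (((Real.sqrt (h y.1))⁻¹ : ℝ) : ℂ) * f y with hg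
  set K : (Fin n → Mode) → ENNReal := fun z =>
    ENNReal.ofReal (∑ i, h (z i).1) * ‖comp ψ n z‖ₑ ^ 2 with hK
  set N : (Fin n → Mode) → ENNReal := fun z => ‖comp ψ n z‖ₑ ^ 2 with hN
  have hKm : AEMeasurable K (nMeasure n) :=
    (measurable_sum_coord hf.measurable_weight n).ennreal_ofReal.aemeasurable.mul
      ((aestronglyMeasurable_comp ψ n).enorm.pow_const 2)
  have hNm : AEMeasurable N (nMeasure n) := (aestronglyMeasurable_comp ψ n).enorm.pow_const 2
  have hfm : AEMeasurable (fun y => ‖f y‖ₑ ^ 2) modeMeasure :=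
    hf.memLp.aestronglyMeasurable.enorm.pow_const 2
  have hgm : AEMeasurable (fun y => ‖g y‖ₑ ^ 2) modeMeasure :=
    hf.memLp_div.aestronglyMeasurable.enorm.pow_const 2
  have m1 (i : Fin (n + 1)) : AEMeasurable
      (fun x : Fin (n + 1) → Mode => ‖f (x i)‖ₑ ^ 2 * N (x ∘ i.succAbove)) (nMeasure (n + 1)) :=
    (hfm.comp_quasiMeasurePreserving (quasiMeasurePreserving_coord i)).mul
      (hNm.comp_quasiMeasurePreserving (quasiMeasurePreserving_remove i))
  have m2 (i : Fin (n + 1)) : AEMeasurable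
      (fun x : Fin (n + 1) → Mode => ‖g (x i)‖ₑ ^ 2 * K (x ∘ i.succAbove)) (nMeasure (n + 1)) :=
    (hgm.comp_quasiMeasurePreserving (quasiMeasurePreserving_coord i)).mul
      (hKm.comp_quasiMeasurePreserving (quasiMeasurePreserving_remove i))
  have hpt : ∀ᵐ x ∂nMeasure (n + 1), ‖(((Real.sqrt (n + 1))⁻¹ : ℝ) : ℂ) *
      ∑ i : Fin (n + 1), f (x i) * comp ψ n (x ∘ i.succAbove)‖ₑ ^ 2
      ≤ ENNReal.ofReal (n + 1 : ℝ)⁻¹ * ∑ i : Fin (n + 1),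
        (‖f (x i)‖ₑ ^ 2 * N (x ∘ i.succAbove) + ‖g (x i)‖ₑ ^ 2 * K (x ∘ i.succAbove)) := by
    filter_upwards [ae_nMeasure_of_ae (ae_modeMeasure_of_ae hf.weight_pos) (n + 1)] with x hx
    have hS : ∀ i : Fin (n + 1), 0 ≤ ∑ j, h (x (i.succAbove j)).1 := fun i =>
      Finset.sum_nonneg fun j _ => (hx _).le
    have e : ∀ i : Fin (n + 1),
        ‖f (x i)‖ₑ ^ 2 * N (x ∘ i.succAbove) + ‖g (x i)‖ₑ ^ 2 * K (x ∘ i.succAbove)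
        = ENNReal.ofReal ((‖f (x i)‖ * ‖comp ψ n (x ∘ i.succAbove)‖) ^ 2
          + (‖f (x i)‖ * ‖comp ψ n (x ∘ i.succAbove)‖) ^ 2 / h (x i).1
            * ∑ j, h (x (i.succAbove j)).1) := by
      intro i
      have hd : 0 ≤ ‖f (x i)‖ ^ 2 / h (x i).1 := div_nonneg (sq_nonneg _) (hx i).le
      simp only [hN, hK, hg, ← ofReal_norm_sq, Function.comp_apply]
      rw [norm_sq_div_weight (hx i), ← ENNReal.ofReal_mul (hS i), ← ENNReal.ofReal_mul hd,
        ← ENNReal.ofReal_mul (sq_nonneg _), ← ENNReal.ofReal_add (by positivity)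
          (mul_nonneg hd (mul_nonneg (hS i) (sq_nonneg _)))]
      congr 1
      ring
    simp only [e]
    rw [← ENNReal.ofReal_sum_of_nonneg fun i _ => add_nonneg (sq_nonneg _)
        (mul_nonneg (div_nonneg (sq_nonneg _) (hx i).le) (hS i)),
      ← ENNReal.ofReal_mul (by positivity), ← ofReal_norm_sq]
    refine ENNReal.ofReal_le_ofReal ?_
    rw [norm_mul, Complex.norm_real, mul_pow, Real.norm_eq_abs, sq_abs, inv_pow,
      Real.sq_sqrt (by positivity)]
    gcongr
    refine le_trans ?_ (sum_sq_le_weighted _ hx)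
    gcongr
    refine (norm_sum_le _ _).trans (le_of_eq ?_)
    simp only [norm_mul]
  refine (lintegral_mono_ae hpt).trans (le_of_eq ?_)
  rw [lintegral_const_mul' _ _ ENNReal.ofReal_ne_top,
    lintegral_finsetSum' (f := fun i x => ‖f (x i)‖ₑ ^ 2 * N (x ∘ i.succAbove)
      + ‖g (x i)‖ₑ ^ 2 * K (x ∘ i.succAbove)) _ fun i _ => (m1 i).add (m2 i)]
  have : ∀ i : Fin (n + 1), ∫⁻ x, (‖f (x i)‖ₑ ^ 2 * N (x ∘ i.succAbove)
      + ‖g (x i)‖ₑ ^ 2 * K (x ∘ i.succAbove)) ∂nMeasure (n + 1)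
      = (∫⁻ y, ‖f y‖ₑ ^ 2 ∂modeMeasure) * (∫⁻ z, N z ∂nMeasure n)
        + (∫⁻ y, ‖g y‖ₑ ^ 2 ∂modeMeasure) * weightInt h ψ n := by
    intro i
    rw [lintegral_add_left' (m1 i), lintegral_removeNth i hfm hNm, lintegral_removeNth i hgm hKm]
    rfl
  simp only [this, Finset.sum_const, Finset.card_univ, Fintype.card_fin, nsmul_eq_mul]
  rw [← mul_assoc]
  have hc : ENNReal.ofReal (n + 1 : ℝ)⁻¹ * ((n + 1 : ℕ) : ENNReal) = 1 := by
    rw [← ENNReal.ofReal_natCast, ← ENNReal.ofReal_mul (by positivity)]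
    push_cast
    rw [inv_mul_cancel₀ (by positivity), ENNReal.ofReal_one]
  rw [hc, one_mul]

theorem dGamma_domain_le_creation {h : R3 → ℝ} {f : Mode → ℂ} (hf : Admissible h f) {ψ : Fock}
    (hψ : ψ ∈ (dGamma h).domain) : ψ ∈ (creation f).domain := by
  have hA0 := (memLp_two_iff_lintegral hf.memLp.aestronglyMeasurable).1 hf.memLp
  have hA1 := (memLp_two_iff_lintegral hf.memLp_div.aestronglyMeasurable).1 hf.memLp_div
  let F : ∀ n, (Fin n → Mode) → ℂ := fun n => match n with
    | 0 => 0
    | n + 1 => fun x => (((Real.sqrt (n + 1))⁻¹ : ℝ) : ℂ) *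
        ∑ i : Fin (n + 1), f (x i) * comp ψ n (x ∘ i.succAbove)
  obtain ⟨φ, hφ⟩ := exists_fock (F := F)
    (fun n => match n with
      | 0 => aestronglyMeasurable_zero
      | n + 1 => aestronglyMeasurable_creation hf.memLp.aestronglyMeasurable ψ n)
    (fun n σ => match n with
      | 0 => Filter.Eventually.of_forall fun x => rfl
      | n + 1 => by
        filter_upwards [creation_symm f ψ σ] with x hx
        exact congrArg ((((Real.sqrt (n + 1))⁻¹ : ℝ) : ℂ) * ·) hx)
    (by
      rw [tsum_eq_zero_add' ENNReal.summable]
      refine ENNReal.add_ne_top.2 ⟨by simp [F], ?_⟩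
      refine ne_top_of_le_ne_top ?_ (ENNReal.tsum_le_tsum fun n => creation_lintegral_le hf ψ n)
      rw [ENNReal.tsum_add, ENNReal.tsum_mul_left, ENNReal.tsum_mul_left]
      exact ENNReal.add_ne_top.2 ⟨ENNReal.mul_ne_top hA0.ne (fock_lintegral_ne_top ψ),
        ENNReal.mul_ne_top hA1.ne (tsum_weightInt_ne_top hψ)⟩)
  refine LinearPMap.mem_domain_iff.2 ⟨φ, mem_creation_graph.2 ⟨?_, fun n => hφ (n + 1)⟩⟩
  refine Subtype.ext (Lp.ext ?_)
  filter_upwards [hφ 0, comp_zero 0] with x hx hx0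
  exact hx.trans hx0.symm

/-! ### Domains of annihilation operators -/

/-- Density is what makes the adjoint defining `a(f)` meaningful, and gives the description of its
graph in `mem_annihilation_graph`. -/
theorem dense_creation {f : Mode → ℂ} (hf : MemLp f 2 modeMeasure) :
    Dense ((creation f).domain : Set Fock) :=
  dense_dGamma_one.mono fun _ hψ => dGamma_domain_le_creation (admissible_one hf) hψ

theorem mem_annihilation_graph {f : Mode → ℂ} (hf : MemLp f 2 modeMeasure) {ψ φ : Fock} :
    (ψ, φ) ∈ (annihilation f).graph ↔
      ∀ η ζ, (η, ζ) ∈ (creation f).graph → ⟪ζ, ψ⟫_ℂ = ⟪η, φ⟫_ℂ := by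
  rw [annihilation, LinearPMap.adjoint_graph_eq_graph_adjoint (dense_creation hf),
    Submodule.mem_adjoint_iff]
  simp only [sub_eq_zero]

theorem enorm_inner_le_lintegral (ψ φ : Fock) (n : ℕ) :
    ‖⟪ψ n, φ n⟫_ℂ‖ₑ ≤ ∫⁻ x, ‖comp ψ n x‖ₑ * ‖comp φ n x‖ₑ ∂nMeasure n := by
  have h : ⟪ψ n, φ n⟫_ℂ = ∫ x, ⟪comp ψ n x, comp φ n x⟫_ℂ ∂nMeasure n := rfl
  rw [h]
  refine (enorm_integral_le_lintegral_enorm _).trans (lintegral_mono fun x => ?_)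
  simp [enorm_mul, mul_comm]

theorem aemeasurable_removeNth {n : ℕ} (i : Fin (n + 1)) {A : Mode → ENNReal}
    {B : (Fin n → Mode) → ENNReal} (hA : AEMeasurable A modeMeasure)
    (hB : AEMeasurable B (nMeasure n)) :
    AEMeasurable (fun x : Fin (n + 1) → Mode => A (x i) * B (x ∘ i.succAbove))
      (nMeasure (n + 1)) :=
  (hA.comp_quasiMeasurePreserving (quasiMeasurePreserving_coord i)).mul
    (hB.comp_quasiMeasurePreserving (quasiMeasurePreserving_remove i))

theorem lintegral_sum_removeNth {n : ℕ} {A : Mode → ENNReal}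
    {B : (Fin n → Mode) → ENNReal} (hA : AEMeasurable A modeMeasure)
    (hB : AEMeasurable B (nMeasure n)) :
    ∫⁻ x, ∑ i : Fin (n + 1), A (x i) * B (x ∘ i.succAbove) ∂nMeasure (n + 1)
      = ((n + 1 : ℕ) : ENNReal) * ((∫⁻ y, A y ∂modeMeasure) * ∫⁻ z, B z ∂nMeasure n) := by
  rw [lintegral_finsetSum' (f := fun i (x : Fin (n + 1) → Mode) => A (x i) * B (x ∘ i.succAbove))
    Finset.univ fun i _ => aemeasurable_removeNth i hA hB]
  simp only [lintegral_removeNth _ hA hB, Finset.sum_const, Finset.card_univ, Fintype.card_fin,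
    nsmul_eq_mul]

/-- The product of the square roots of the two terms on the right is the left-hand side, so this is
the arithmetic–geometric inequality with a factor to spare. -/
theorem mul_le_weighted_sq {s a b c w : ℝ} (hs : 0 ≤ s) (ha : 0 ≤ a) (hb : 0 ≤ b) (hc : 0 ≤ c)
    (hw : 0 < w) : s * (a * b) * c ≤ s ^ 2 * (a ^ 2 / w * b ^ 2) + w * c ^ 2 := by
  have key : s ^ 2 * (a ^ 2 / w * b ^ 2) + w * c ^ 2 - s * (a * b) * c
      = ((s * (a * b) - w * c) ^ 2 + s * (a * b) * c * w) / w := by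
    field_simp
    ring
  have : 0 ≤ ((s * (a * b) - w * c) ^ 2 + s * (a * b) * c * w) / w := by positivity
  linarith

/-- The `i`-th summand of `a(f)*η` is paired with `ψ` using the weight `h(xᵢ)` in
`mul_le_weighted_sq`. The terms containing `ψ` add up to the form of `dΓ(h)`, and the terms
containing `η` are `n + 1` equal integrals divided by `n + 1`. -/
theorem creation_inner_le {h : R3 → ℝ} {f : Mode → ℂ} (hf : Admissible h f) {η ζ : Fock}
    (hη : (η, ζ) ∈ (creation f).graph) (ψ : Fock) (n : ℕ) :
    ‖⟪ζ (n + 1), ψ (n + 1)⟫_ℂ‖ₑ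
      ≤ (∫⁻ y, ‖(((Real.sqrt (h y.1))⁻¹ : ℝ) : ℂ) * f y‖ₑ ^ 2 ∂modeMeasure)
          * (∫⁻ z, ‖comp η n z‖ₑ ^ 2 ∂nMeasure n) + weightInt h ψ (n + 1) := by
  refine (enorm_inner_le_lintegral ζ ψ (n + 1)).trans ?_
  set g : Mode → ℂ := fun y => (((Real.sqrt (h y.1))⁻¹ : ℝ) : ℂ) * f y with hg
  set N : (Fin n → Mode) → ENNReal := fun z => ‖comp η n z‖ₑ ^ 2 with hN
  have hNm : AEMeasurable N (nMeasure n) := (aestronglyMeasurable_comp η n).enorm.pow_const 2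
  have hgm : AEMeasurable (fun y => ‖g y‖ₑ ^ 2) modeMeasure :=
    hf.memLp_div.aestronglyMeasurable.enorm.pow_const 2
  have hpt : ∀ᵐ x ∂nMeasure (n + 1), ‖comp ζ (n + 1) x‖ₑ * ‖comp ψ (n + 1) x‖ₑ
      ≤ ENNReal.ofReal (n + 1 : ℝ)⁻¹ * ∑ i : Fin (n + 1), ‖g (x i)‖ₑ ^ 2 * N (x ∘ i.succAbove)
        + ENNReal.ofReal (∑ i, h (x i).1) * ‖comp ψ (n + 1) x‖ₑ ^ 2 := by
    filter_upwards [ae_nMeasure_of_ae (ae_modeMeasure_of_ae hf.weight_pos) (n + 1),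
      (mem_creation_graph.1 hη).2 n] with x hx hx'
    have e : ∀ i : Fin (n + 1), ‖g (x i)‖ₑ ^ 2 * N (x ∘ i.succAbove)
        = ENNReal.ofReal (‖f (x i)‖ ^ 2 / h (x i).1 * ‖comp η n (x ∘ i.succAbove)‖ ^ 2) := by
      intro i
      have hd : 0 ≤ ‖f (x i)‖ ^ 2 / h (x i).1 := div_nonneg (sq_nonneg _) (hx i).le
      simp only [hN, hg, ← ofReal_norm_sq]
      rw [norm_sq_div_weight (hx i), ← ENNReal.ofReal_mul hd]
    have hpos : ∀ i : Fin (n + 1),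
        0 ≤ ‖f (x i)‖ ^ 2 / h (x i).1 * ‖comp η n (x ∘ i.succAbove)‖ ^ 2 := fun i =>
      mul_nonneg (div_nonneg (sq_nonneg _) (hx i).le) (sq_nonneg _)
    have hS : 0 ≤ ∑ i, h (x i).1 := Finset.sum_nonneg fun i _ => (hx i).le
    simp only [e]
    rw [← ENNReal.ofReal_sum_of_nonneg fun i _ => hpos i, ← ENNReal.ofReal_mul (by positivity),
      ← ofReal_norm_sq, ← ENNReal.ofReal_mul hS, ← ENNReal.ofReal_add
        (mul_nonneg (by positivity) (Finset.sum_nonneg fun i _ => hpos i))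
        (mul_nonneg hS (sq_nonneg _)), ← ofReal_norm, ← ofReal_norm,
      ← ENNReal.ofReal_mul (norm_nonneg _)]
    refine ENNReal.ofReal_le_ofReal ?_
    rw [hx', norm_mul, Complex.norm_real, Finset.mul_sum, Finset.sum_mul, ← Finset.sum_add_distrib]
    have h1 : ‖∑ i : Fin (n + 1), f (x i) * comp η n (x ∘ i.succAbove)‖
        ≤ ∑ i : Fin (n + 1), ‖f (x i)‖ * ‖comp η n (x ∘ i.succAbove)‖ :=
      (norm_sum_le _ _).trans (le_of_eq (by simp only [norm_mul]))
    rw [Real.norm_eq_abs, abs_of_nonneg (by positivity)]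
    refine (mul_le_mul_of_nonneg_right (mul_le_mul_of_nonneg_left h1 (by positivity))
      (norm_nonneg _)).trans ?_
    rw [Finset.mul_sum, Finset.sum_mul]
    refine Finset.sum_le_sum fun i _ => ?_
    have hn : (n + 1 : ℝ)⁻¹ = ((Real.sqrt (n + 1))⁻¹) ^ 2 := by
      rw [inv_pow, Real.sq_sqrt (by positivity)]
    rw [hn]
    exact mul_le_weighted_sq (by positivity) (norm_nonneg _) (norm_nonneg _) (norm_nonneg _) (hx i)
  refine (lintegral_mono_ae hpt).trans (le_of_eq ?_)
  have m3 : AEMeasurable (fun x : Fin (n + 1) → Mode =>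
      ∑ i : Fin (n + 1), ‖g (x i)‖ₑ ^ 2 * N (x ∘ i.succAbove)) (nMeasure (n + 1)) :=
    Finset.aemeasurable_fun_sum _ fun i _ => aemeasurable_removeNth i hgm hNm
  have h1 : ∫⁻ x, ∑ i : Fin (n + 1), ‖g (x i)‖ₑ ^ 2 * N (x ∘ i.succAbove) ∂nMeasure (n + 1)
      = ((n + 1 : ℕ) : ENNReal) * ((∫⁻ y, ‖g y‖ₑ ^ 2 ∂modeMeasure) * ∫⁻ z, N z ∂nMeasure n) :=
    lintegral_sum_removeNth hgm hNm
  have hc : ENNReal.ofReal (n + 1 : ℝ)⁻¹ * ((n + 1 : ℕ) : ENNReal) = 1 := by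
    rw [← ENNReal.ofReal_natCast, ← ENNReal.ofReal_mul (by positivity)]
    push_cast
    rw [inv_mul_cancel₀ (by positivity), ENNReal.ofReal_one]
  rw [lintegral_add_left' (m3.const_mul _), lintegral_const_mul' _ _ ENNReal.ofReal_ne_top, h1,
    ← mul_assoc, hc, one_mul, weightInt]

/-- A vector is in the domain of the adjoint when `η ↦ ⟨ψ, a(f)*η⟩` is bounded. Summing
`creation_inner_le` over the sectors gives a bound by `A‖η‖² + K`, which is enough by scaling; no
formula for `a(f)` is used. -/
theorem dGamma_domain_le_annihilation {h : R3 → ℝ} {f : Mode → ℂ} (hf : Admissible h f)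
    {ψ : Fock} (hψ : ψ ∈ (dGamma h).domain) : ψ ∈ (annihilation f).domain := by
  have hA1 := (memLp_two_iff_lintegral hf.memLp_div.aestronglyMeasurable).1 hf.memLp_div
  set A := ∫⁻ y, ‖(((Real.sqrt (h y.1))⁻¹ : ℝ) : ℂ) * f y‖ₑ ^ 2 ∂modeMeasure with hA
  have hK := tsum_weightInt_ne_top hψ
  set K := ∑' n, weightInt h ψ n with hKdef
  have hle : ∀ η ζ, (η, ζ) ∈ (creation f).graph → ‖⟪ζ, ψ⟫_ℂ‖ₑ ≤ A * ‖η‖ₑ ^ 2 + K := by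
    intro η ζ hη
    have h0 : ζ 0 = 0 := (mem_creation_graph.1 hη).1
    rw [lp.inner_eq_tsum]
    refine enorm_tsum_le_tsum_enorm.trans ?_
    rw [tsum_eq_zero_add' ENNReal.summable, h0, inner_zero_left, enorm_zero, zero_add]
    refine (ENNReal.tsum_le_tsum fun n => creation_inner_le hf hη ψ n).trans ?_
    rw [ENNReal.tsum_add, ENNReal.tsum_mul_left, ← fock_enorm_sq]
    gcongr
    rw [hKdef, tsum_eq_zero_add' (f := weightInt h ψ) ENNReal.summable]
    exact le_add_self
  have hbound : ∀ x : (creation f).domain,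
      ‖⟪ψ, creation f x⟫_ℂ‖ ≤ (A + K).toReal * ‖x‖ := by
    intro x
    by_cases hx : (x : Fock) = 0
    · have : x = 0 := Subtype.ext hx
      simp [this]
    have hnx : ‖(x : Fock)‖ ≠ 0 := by simpa using hx
    -- The bound is not homogeneous in `η`, so it is applied to the normalized vector.
    have h1 := hle _ _ ((creation f).graph.smul_mem (((‖(x : Fock)‖⁻¹ : ℝ)) : ℂ)
      ((creation f).mem_graph x))
    have h2 : ‖(((‖(x : Fock)‖⁻¹ : ℝ)) : ℂ) • (x : Fock)‖ₑ = 1 := by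
      rw [← ofReal_norm, norm_smul, Complex.norm_real]
      simp [hnx]
    rw [h2, one_pow, mul_one, inner_smul_left, enorm_mul] at h1
    have h3 := ENNReal.toReal_mono (ENNReal.add_ne_top.2 ⟨hA1.ne, hK⟩) h1
    simp only [ENNReal.toReal_mul, toReal_enorm, Complex.conj_ofReal, Complex.norm_real,
      norm_inv, norm_norm] at h3
    rw [norm_inner_symm, Submodule.coe_norm]
    rwa [inv_mul_le_iff₀ (by positivity), mul_comm ‖(x : Fock)‖] at h3
  exact AddMonoidHomClass.continuous_of_bound
    ((innerₛₗ ℂ ψ).comp (creation f).toFun) _ hbound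

/-! ### Linearity in the coupling function -/

theorem creation_graph_congr {f g : Mode → ℂ} (h : f =ᵐ[modeMeasure] g) :
    (creation f).graph = (creation g).graph := by
  have key : ∀ f g : Mode → ℂ, f =ᵐ[modeMeasure] g → (creation f).graph ≤ (creation g).graph := by
    rintro f g h ⟨ψ, φ⟩ hz
    rw [mem_creation_graph] at hz ⊢
    refine ⟨hz.1, fun n => ?_⟩
    filter_upwards [hz.2 n, ae_nMeasure_of_ae h (n + 1)] with x hx hx'
    rw [hx]
    simp only [hx']
  exact le_antisymm (key f g h) (key g f h.symm)

theorem annihilation_congr {f g : Mode → ℂ} (h : f =ᵐ[modeMeasure] g) :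
    annihilation f = annihilation g := by
  rw [annihilation, annihilation, LinearPMap.eq_of_eq_graph (creation_graph_congr h)]

theorem comp_sum {ι : Type*} (s : Finset ι) (ψ : ι → Fock) (n : ℕ) :
    ∀ᵐ x ∂nMeasure n, comp (∑ i ∈ s, ψ i) n x = ∑ i ∈ s, comp (ψ i) n x := by
  classical
  induction s using Finset.induction_on with
  | empty => simpa using comp_zero n
  | insert i s hi ih =>
    rw [Finset.sum_insert hi]
    filter_upwards [ih, comp_add (ψ i) (∑ j ∈ s, ψ j) n] with x h1 h2
    rw [h2, h1, Finset.sum_insert hi]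

theorem creation_graph_sum {ι : Type*} [Fintype ι] (t : ι → ℝ) (f : ι → Mode → ℂ) {ψ : Fock}
    {φ : ι → Fock} (h : ∀ i, (ψ, φ i) ∈ (creation (f i)).graph) :
    (ψ, ∑ i, (t i : ℂ) • φ i) ∈ (creation fun x => ∑ i, (t i : ℂ) * f i x).graph := by
  simp only [mem_creation_graph] at h ⊢
  refine ⟨?_, fun n => ?_⟩
  · rw [lp.coeFn_sum, Finset.sum_apply]
    refine Finset.sum_eq_zero fun i _ => ?_
    rw [lp.coeFn_smul, Pi.smul_apply, (h i).1, smul_zero]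
  · filter_upwards [comp_sum Finset.univ (fun i => (t i : ℂ) • φ i) (n + 1),
      ae_all_iff.2 fun i => comp_smul (t i : ℂ) (φ i) (n + 1),
      ae_all_iff.2 fun i => (h i).2 n] with x h1 h2 h3
    rw [h1]
    simp only [h2, h3, Finset.mul_sum, Finset.sum_mul]
    rw [Finset.sum_comm]
    exact Finset.sum_congr rfl fun i _ => Finset.sum_congr rfl fun j _ => by ring

/-- `a(f)` is antilinear in `f`, so real coefficients are essential here. The identity is tested on
the domain of the number operator, where all the creation operators are defined together. -/
theorem annihilation_graph_sum {ι : Type*} [Fintype ι] (t : ι → ℝ) {f : ι → Mode → ℂ}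
    (hf : ∀ i, MemLp (f i) 2 modeMeasure) {ψ χ : Fock} {φ : ι → Fock}
    (h : ∀ i, (ψ, φ i) ∈ (annihilation (f i)).graph)
    (hχ : (ψ, χ) ∈ (annihilation fun x => ∑ i, (t i : ℂ) * f i x).graph) :
    χ = ∑ i, (t i : ℂ) • φ i := by
  have hF : MemLp (fun x => ∑ i, (t i : ℂ) * f i x) 2 modeMeasure :=
    memLp_finsetSum _ fun i _ => (hf i).const_mul _
  rw [mem_annihilation_graph hF] at hχ
  refine dense_dGamma_one.eq_of_inner_right ℂ fun η hη => ?_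
  have h1 : ∀ i, ∃ ζ, (η, ζ) ∈ (creation (f i)).graph := fun i =>
    LinearPMap.mem_domain_iff.1 (dGamma_domain_le_creation (admissible_one (hf i)) hη)
  choose ζ hζ using h1
  rw [← hχ _ _ (creation_graph_sum t f hζ), sum_inner, inner_sum]
  refine Finset.sum_congr rfl fun i _ => ?_
  rw [inner_smul_left, inner_smul_right, Complex.conj_ofReal,
    (mem_annihilation_graph (hf i)).1 (h i) _ _ (hζ i)]

theorem mem_segalField_graph {f : Mode → ℂ} {ψ b c : Fock}
    (hb : (ψ, b) ∈ (annihilation f).graph) (hc : (ψ, c) ∈ (creation f).graph) :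
    (ψ, ((Real.sqrt 2)⁻¹ : ℂ) • (b + c)) ∈ (segalField f).graph := by
  refine LinearPMap.le_graph_of_le (LinearPMap.le_closure _) ?_
  obtain ⟨y, hy, rfl⟩ := (LinearPMap.mem_graph_iff _).1 hb
  obtain ⟨z, hz, rfl⟩ := (LinearPMap.mem_graph_iff _).1 hc
  simp only at hy hz
  subst hy
  refine (LinearPMap.mem_graph_iff _).2 ⟨⟨y, y.2, hz ▸ z.2⟩, rfl, ?_⟩
  simp only [LinearPMap.smul_apply, LinearPMap.add_apply]
  congr 3
  exact Subtype.ext hz.symm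

/-! ### Rotations of functions with finitely many labels -/

/-- Data for a transformation `(V f)(x) = ∑_r M(x)_{ℓ(x), r} f(R_r x)`, where a point `x` consists of
a base point and a label `ℓ(x)`, `rep_r x` replaces the label by `r`, and `R_r x` also moves the
base point. -/
structure LabelRotation (X : Type*) [MeasurableSpace X] (μ : Measure X) (C : Type*) [Fintype C]
    [DecidableEq C] [AddGroup C] [MeasurableSpace C] where
  label : X → C
  rep : C → X → X
  R : C → X → X
  M : X → Matrix C C ℂ
  measurable_label : Measurable label
  measurable_M : ∀ l r, Measurable fun x => M x l r
  label_rep : ∀ c x, label (rep c x) = c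
  rep_label : ∀ x, rep (label x) x = x
  R_rep : ∀ r c x, R r (rep c x) = R r x
  M_rep : ∀ c x, M (rep c x) = M x
  unitary : ∀ x, star (M x) * M x = 1
  -- For fixed `r` the map `R r` collapses all labels to `r` and does not preserve the measure.
  -- Shifting the label by `c` does, and the shifts by all `c` run over the same labels.
  measurePreserving_R : ∀ c, MeasurePreserving (fun x => R (label x + c) x) μ μ
  measurePreserving_rep : ∀ c, MeasurePreserving (fun x => rep (label x + c) x) μ μ

namespace LabelRotation

variable {X : Type*} [MeasurableSpace X] {μ : Measure X} {C : Type*} [Fintype C]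
  [DecidableEq C] [AddGroup C] [MeasurableSpace C] (D : LabelRotation X μ C)

/-- The transformation of functions. -/
def app (f : X → ℂ) (x : X) : ℂ := ∑ r, D.M x (D.label x) r * f (D.R r x)

theorem app_eq_shift (f : X → ℂ) (x : X) :
    D.app f x = ∑ c, D.M x (D.label x) (D.label x + c) * f (D.R (D.label x + c) x) :=
  (Equiv.sum_comp (Equiv.addLeft (D.label x))
    fun r => D.M x (D.label x) r * f (D.R r x)).symm

theorem ae_R {P : X → Prop} (h : ∀ᵐ x ∂μ, P x) : ∀ᵐ x ∂μ, ∀ r, P (D.R r x) := by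
  have h1 : ∀ᵐ x ∂μ, ∀ c, P (D.R (D.label x + c) x) :=
    ae_all_iff.2 fun c => (D.measurePreserving_R c).quasiMeasurePreserving.ae h
  filter_upwards [h1] with x hx r
  simpa using hx (-D.label x + r)

theorem app_congr {f g : X → ℂ} (h : f =ᵐ[μ] g) : D.app f =ᵐ[μ] D.app g := by
  filter_upwards [D.ae_R h] with x hx
  simp only [app, hx]

/-- `D'` is a left inverse of `D`. -/
structure IsLeftInverse (D' D : LabelRotation X μ C) : Prop where
  label_R : ∀ r x, D.label (D'.R r x) = r
  R_R : ∀ s r x, D.R s (D'.R r x) = D'.rep s x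
  M_mul : ∀ r x, D'.M x * D.M (D'.R r x) = 1
  M_R : ∀ r s x, D.M (D'.R r x) = D.M (D'.R s x)

/-- The matrices are evaluated at `R_r x`, but `M_R` says that they do not see `r`; the sum over `r`
is then the product of two mutually inverse matrices. -/
theorem app_app {D' D : LabelRotation X μ C} (h : IsLeftInverse D' D) (f : X → ℂ) :
    D'.app (D.app f) = f := by
  funext x
  have hM : ∀ r, D.M (D'.R r x) = D.M (D'.R 0 x) := fun r => h.M_R r 0 x
  simp only [app, h.label_R, h.R_R, hM, Finset.mul_sum]
  rw [Finset.sum_comm]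
  simp only [← mul_assoc, ← Finset.sum_mul]
  have h1 : ∀ s, ∑ r, D'.M x (D'.label x) r * D.M (D'.R 0 x) r s
      = if D'.label x = s then 1 else 0 := by
    intro s
    rw [← Matrix.mul_apply, h.M_mul, Matrix.one_apply]
  simp only [h1, ite_mul, one_mul, zero_mul, Finset.sum_ite_eq, Finset.mem_univ, if_true,
    D'.rep_label]

variable [MeasurableSingletonClass C]

theorem aestronglyMeasurable_app {f : X → ℂ} (hf : AEStronglyMeasurable f μ) :
    AEStronglyMeasurable (D.app f) μ := by
  have e : D.app f = fun x =>
      ∑ c, D.M x (D.label x) (D.label x + c) * f (D.R (D.label x + c) x) :=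
    funext (D.app_eq_shift f)
  rw [e]
  refine Finset.aestronglyMeasurable_fun_sum _ fun c _ => AEStronglyMeasurable.mul ?_
    (hf.comp_quasiMeasurePreserving (D.measurePreserving_R c).quasiMeasurePreserving)
  have : (fun x => D.M x (D.label x) (D.label x + c))
      = fun x => ∑ l, if D.label x = l then D.M x l (l + c) else 0 := by
    funext x
    simp
  rw [this]
  exact (Finset.measurable_sum _ fun l _ => Measurable.ite
    (D.measurable_label (measurableSet_singleton l)) (D.measurable_M _ _)
    measurable_const).aestronglyMeasurable

theorem _root_.DiracPolaron.sum_enorm_sq_mulVec {C : Type*} [Fintype C] [DecidableEq C]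
    {M : Matrix C C ℂ} (hM : star M * M = 1) (v : C → ℂ) :
    ∑ l, ‖∑ r, M l r * v r‖ₑ ^ 2 = ∑ r, ‖v r‖ₑ ^ 2 := by
  have h1 : star (M.mulVec v) ⬝ᵥ (M.mulVec v) = star v ⬝ᵥ v := by
    rw [Matrix.star_mulVec, ← Matrix.dotProduct_mulVec, Matrix.mulVec_mulVec,
      ← Matrix.star_eq_conjTranspose, hM, Matrix.one_mulVec]
  have h2 : ∀ w : C → ℂ, star w ⬝ᵥ w = ((∑ i, ‖w i‖ ^ 2 : ℝ) : ℂ) := by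
    intro w
    simp only [dotProduct, Pi.star_apply, Complex.ofReal_sum, Complex.ofReal_pow]
    exact Finset.sum_congr rfl fun i _ => Complex.conj_mul' (w i)
  rw [h2, h2, Complex.ofReal_inj] at h1
  simp only [← ofReal_norm_sq]
  rw [← ENNReal.ofReal_sum_of_nonneg fun _ _ => sq_nonneg _,
    ← ENNReal.ofReal_sum_of_nonneg fun _ _ => sq_nonneg _]
  exact congrArg _ h1

/-- For fixed base point, unitarity of `M` preserves the sum over the labels of the squared moduli.
Each label shift preserves the measure, so integrating this identity gives the claim multiplied by
the number of labels, which cancels. -/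
theorem lintegral_app {f : X → ℂ} (hf : AEStronglyMeasurable f μ) :
    ∫⁻ x, ‖D.app f x‖ₑ ^ 2 ∂μ = ∫⁻ x, ‖f x‖ₑ ^ 2 ∂μ := by
  have hg := D.aestronglyMeasurable_app hf
  have hpre : ∀ {S : X → X} {F : X → ℂ}, MeasurePreserving S μ μ → AEStronglyMeasurable F μ →
      ∫⁻ x, ‖F (S x)‖ₑ ^ 2 ∂μ = ∫⁻ x, ‖F x‖ₑ ^ 2 ∂μ := by
    intro S F hS hF
    have hF' : AEMeasurable (fun x => ‖F x‖ₑ ^ 2) (μ.map S) := by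
      rw [hS.map_eq]
      exact hF.enorm.pow_const 2
    rw [← lintegral_map' hF' hS.measurable.aemeasurable, hS.map_eq]
  have h1 : ∫⁻ x, ∑ c, ‖D.app f (D.rep (D.label x + c) x)‖ₑ ^ 2 ∂μ
      = ∫⁻ x, ∑ c, ‖f (D.R (D.label x + c) x)‖ₑ ^ 2 ∂μ := by
    refine lintegral_congr fun x => ?_
    have e1 := Equiv.sum_comp (Equiv.addLeft (D.label x))
      fun l => ‖D.app f (D.rep l x)‖ₑ ^ 2
    have e2 := Equiv.sum_comp (Equiv.addLeft (D.label x)) fun r => ‖f (D.R r x)‖ₑ ^ 2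
    simp only [Equiv.coe_addLeft] at e1 e2
    rw [e1, e2]
    simp only [app, D.label_rep, D.M_rep, D.R_rep]
    exact sum_enorm_sq_mulVec (D.unitary x) fun r => f (D.R r x)
  have m1 : ∀ c, AEMeasurable (fun x => ‖D.app f (D.rep (D.label x + c) x)‖ₑ ^ 2) μ := fun c =>
    (hg.comp_quasiMeasurePreserving
      (D.measurePreserving_rep c).quasiMeasurePreserving).enorm.pow_const 2
  have m2 : ∀ c, AEMeasurable (fun x => ‖f (D.R (D.label x + c) x)‖ₑ ^ 2) μ := fun c =>
    (hf.comp_quasiMeasurePreserving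
      (D.measurePreserving_R c).quasiMeasurePreserving).enorm.pow_const 2
  rw [lintegral_finsetSum' _ fun c _ => m1 c, lintegral_finsetSum' _ fun c _ => m2 c] at h1
  simp only [fun c => hpre (D.measurePreserving_rep c) hg,
    fun c => hpre (D.measurePreserving_R c) hf, Finset.sum_const, Finset.card_univ,
    nsmul_eq_mul] at h1
  exact (ENNReal.mul_right_inj (by simp) (ENNReal.natCast_ne_top _)).1 h1

theorem memLp_app {f : X → ℂ} (hf : MemLp f 2 μ) : MemLp (D.app f) 2 μ := by
  rw [memLp_two_iff_lintegral (D.aestronglyMeasurable_app hf.1), D.lintegral_app hf.1]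
  exact (memLp_two_iff_lintegral hf.1).1 hf

/-- The induced isometry of `L²`. -/
def lpIsometry : Lp ℂ 2 μ →ₗᵢ[ℂ] Lp ℂ 2 μ where
  toFun f := (D.memLp_app (Lp.memLp f)).toLp
  map_add' f g := by
    refine Lp.ext ?_
    filter_upwards [(D.memLp_app (Lp.memLp (f + g))).coeFn_toLp,
      (D.memLp_app (Lp.memLp f)).coeFn_toLp, (D.memLp_app (Lp.memLp g)).coeFn_toLp,
      Lp.coeFn_add (D.memLp_app (Lp.memLp f)).toLp (D.memLp_app (Lp.memLp g)).toLp,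
      D.app_congr (Lp.coeFn_add f g)] with x h1 h2 h3 h4 h5
    rw [h1, h4, Pi.add_apply, h2, h3, h5]
    simp only [app, Pi.add_apply, mul_add, Finset.sum_add_distrib]
  map_smul' c f := by
    refine Lp.ext ?_
    filter_upwards [(D.memLp_app (Lp.memLp (c • f))).coeFn_toLp,
      (D.memLp_app (Lp.memLp f)).coeFn_toLp,
      Lp.coeFn_smul c (D.memLp_app (Lp.memLp f)).toLp,
      D.app_congr (Lp.coeFn_smul c f)] with x h1 h2 h3 h4
    rw [h1, RingHom.id_apply, h3, Pi.smul_apply, h2, h4]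
    simp only [app, Pi.smul_apply, smul_eq_mul, Finset.mul_sum]
    exact Finset.sum_congr rfl fun r _ => by ring
  norm_map' f := by
    have h : ‖(D.memLp_app (Lp.memLp f)).toLp‖ₑ ^ 2 = ‖f‖ₑ ^ 2 := by
      rw [Lp_enorm_sq, Lp_enorm_sq, ← D.lintegral_app (Lp.aestronglyMeasurable f)]
      refine lintegral_congr_ae ?_
      filter_upwards [(D.memLp_app (Lp.memLp f)).coeFn_toLp] with x hx
      rw [hx]
    rw [← ofReal_norm_sq, ← ofReal_norm_sq,
      ENNReal.ofReal_eq_ofReal_iff (sq_nonneg _) (sq_nonneg _)] at h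
    exact (sq_eq_sq₀ (norm_nonneg _) (norm_nonneg _)).1 h

theorem coeFn_lpIsometry (f : Lp ℂ 2 μ) : D.lpIsometry f =ᵐ[μ] D.app f :=
  (D.memLp_app (Lp.memLp f)).coeFn_toLp

theorem lpIsometry_lpIsometry {D' D : LabelRotation X μ C} (h : IsLeftInverse D' D)
    (f : Lp ℂ 2 μ) : D'.lpIsometry (D.lpIsometry f) = f := by
  refine Lp.ext ?_
  filter_upwards [D'.coeFn_lpIsometry (D.lpIsometry f), D'.app_congr (D.coeFn_lpIsometry f)]
    with x h1 h2
  rw [h1, h2, app_app h]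

end LabelRotation

/-! ### Rotations of photons -/

/-- An orthogonal matrix together with a measurable field of unitary polarization matrices. -/
structure RotationData where
  T : Matrix (Fin 3) (Fin 3) ℝ
  hT : T ∈ Matrix.orthogonalGroup (Fin 3) ℝ
  B : R3 → Matrix (Fin 2) (Fin 2) ℂ
  measurable_B : ∀ l r, Measurable fun k => B k l r
  unitary_B : ∀ k, B k ∈ Matrix.unitaryGroup (Fin 2) ℂ

theorem measurable_act (T : Matrix (Fin 3) (Fin 3) ℝ) : Measurable (act T) := by
  have : Continuous (act T) := by
    unfold act
    fun_prop
  exact this.measurable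

theorem measurePreserving_mode {S : R3 → R3} (hS : MeasurePreserving S volume volume)
    (c : Fin 2) :
    MeasurePreserving (fun x : Mode => (S x.1, x.2 + c)) modeMeasure modeMeasure := by
  have h : MeasurePreserving (fun l : Fin 2 => l + c) Measure.count Measure.count := by
    refine ⟨measurable_of_countable _, ?_⟩
    ext s hs
    rw [Measure.map_apply (measurable_of_countable _) hs, Measure.count_apply_finite _ (Set.toFinite _),
      Measure.count_apply_finite _ (Set.toFinite _)]
    congr 1
    refine Finset.card_bij (fun a _ => a + c) ?_ ?_ ?_
    · intro a ha; simpa using ha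
    · intro a _ b _ hab; exact add_right_cancel hab
    · intro b hb; exact ⟨b - c, by simpa using hb, by simp⟩
  exact hS.prod h

theorem measurePreserving_modes {S : R3 → R3} (hS : MeasurePreserving S volume volume) {n : ℕ}
    (c : Fin n → Fin 2) :
    MeasurePreserving (fun (x : Fin n → Mode) i => ((S (x i).1, (x i).2 + c i) : Mode))
      (nMeasure n) (nMeasure n) :=
  measurePreserving_pi _ _ fun i => measurePreserving_mode hS (c i)

/-- The tensor product of square matrices. -/
def tensorMatrix {n : ℕ} (A : Fin n → Matrix (Fin 2) (Fin 2) ℂ) :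
    Matrix (Fin n → Fin 2) (Fin n → Fin 2) ℂ := fun l r => ∏ i, A i (l i) (r i)

theorem tensorMatrix_mul {n : ℕ} (A A' : Fin n → Matrix (Fin 2) (Fin 2) ℂ) :
    tensorMatrix A * tensorMatrix A' = tensorMatrix fun i => A i * A' i := by
  ext l r
  simp only [tensorMatrix, Matrix.mul_apply, ← Finset.prod_mul_distrib, Finset.prod_univ_sum,
    Fintype.piFinset_univ]

theorem tensorMatrix_one {n : ℕ} :
    tensorMatrix (fun _ : Fin n => (1 : Matrix (Fin 2) (Fin 2) ℂ)) = 1 := by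
  ext l r
  simp only [tensorMatrix, Matrix.one_apply, Finset.prod_ite_zero, Finset.prod_const_one,
    Finset.mem_univ, true_imp_iff, funext_iff]

theorem star_tensorMatrix {n : ℕ} (A : Fin n → Matrix (Fin 2) (Fin 2) ℂ) :
    star (tensorMatrix A) = tensorMatrix fun i => star (A i) := by
  ext l r
  simp [tensorMatrix, Matrix.star_apply]

namespace RotationData

variable (P : RotationData)

theorem hTt : P.T.transpose ∈ Matrix.orthogonalGroup (Fin 3) ℝ :=
  transpose_mem_orthogonalGroup P.hT

/-- The transformation of one-photon functions. -/
def one : LabelRotation Mode modeMeasure (Fin 2) where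
  label x := x.2
  rep r x := (x.1, r)
  R r x := (act P.T.transpose x.1, r)
  M x := P.B x.1
  measurable_label := measurable_snd
  measurable_M l r := (P.measurable_B l r).comp measurable_fst
  label_rep _ _ := rfl
  rep_label _ := rfl
  R_rep _ _ _ := rfl
  M_rep _ _ := rfl
  unitary x := Matrix.mem_unitaryGroup_iff'.1 (P.unitary_B x.1)
  measurePreserving_R c := measurePreserving_mode (measurePreserving_act P.hTt) c
  measurePreserving_rep c := measurePreserving_mode (MeasurePreserving.id _) c

/-- The transformation of `n`-photon functions. -/
def many (n : ℕ) : LabelRotation (Fin n → Mode) (nMeasure n) (Fin n → Fin 2) where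
  label x i := (x i).2
  rep r x i := ((x i).1, r i)
  R r x i := (act P.T.transpose (x i).1, r i)
  M x := tensorMatrix fun i => P.B (x i).1
  measurable_label := measurable_pi_lambda _ fun i => measurable_snd.comp (measurable_pi_apply i)
  measurable_M l r := by
    unfold tensorMatrix
    exact Finset.measurable_prod _ fun i _ => (P.measurable_B (l i) (r i)).comp
      (measurable_fst.comp (measurable_pi_apply i))
  label_rep _ _ := rfl
  rep_label _ := rfl
  R_rep _ _ _ := rfl
  M_rep _ _ := rfl
  unitary x := by
    rw [star_tensorMatrix, tensorMatrix_mul]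
    simp only [fun i => Matrix.mem_unitaryGroup_iff'.1 (P.unitary_B (x i).1), tensorMatrix_one]
  measurePreserving_R c := measurePreserving_modes (measurePreserving_act P.hTt) c
  measurePreserving_rep c := measurePreserving_modes (MeasurePreserving.id _) c

/-- The inverse rotation. -/
def inv : RotationData where
  T := P.T.transpose
  hT := P.hTt
  B k := star (P.B (act P.T k))
  measurable_B l r := by
    have : (fun k => (star (P.B (act P.T k))) l r) = fun k => star (P.B (act P.T k) r l) := by
      funext k
      rw [Matrix.star_apply]
    rw [this]
    exact Complex.continuous_conj.measurable.comp
      ((P.measurable_B r l).comp (measurable_act P.T))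
  unitary_B k := Unitary.star_mem (P.unitary_B _)

theorem act_transpose_act (k : R3) : act P.T.transpose (act P.T k) = k := by
  rw [← act_mul, transpose_mul_self P.hT, act_one]

/-- Only left inverses are verified directly; applying them to `P.inv` gives the right inverses. -/
theorem inv_inv : P.inv.inv = P := by
  cases P with
  | mk T hT B h1 h2 =>
    simp only [inv, Matrix.transpose_transpose, star_star, mk.injEq, true_and]
    funext k
    rw [← act_mul, mul_transpose_self hT, act_one]

theorem one_inv : LabelRotation.IsLeftInverse P.inv.one P.one where
  label_R _ _ := rfl
  R_R s r x := by
    change (act P.T.transpose (act P.T.transpose.transpose x.1), s) = (x.1, s)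
    rw [Matrix.transpose_transpose, P.act_transpose_act]
  M_mul r x := by
    change star (P.B (act P.T x.1)) * P.B (act P.T.transpose.transpose x.1) = 1
    rw [Matrix.transpose_transpose]
    exact Matrix.mem_unitaryGroup_iff'.1 (P.unitary_B _)
  M_R _ _ _ := rfl

theorem many_inv (n : ℕ) : LabelRotation.IsLeftInverse (P.inv.many n) (P.many n) where
  label_R _ _ := rfl
  R_R s r x := by
    funext i
    change (act P.T.transpose (act P.T.transpose.transpose (x i).1), s i) = ((x i).1, s i)
    rw [Matrix.transpose_transpose, P.act_transpose_act]
  M_mul r x := by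
    change (tensorMatrix fun i => star (P.B (act P.T (x i).1))) *
      tensorMatrix (fun i => P.B (act P.T.transpose.transpose (x i).1)) = 1
    rw [Matrix.transpose_transpose, tensorMatrix_mul]
    simp only [fun i => Matrix.mem_unitaryGroup_iff'.1 (P.unitary_B (act P.T (x i).1)),
      tensorMatrix_one]
  M_R _ _ _ := rfl

/-- The rotation as a unitary operator on the one-photon space. -/
def W : OnePhoton ≃ₗᵢ[ℂ] OnePhoton where
  toLinearEquiv := LinearEquiv.ofLinearMap P.one.lpIsometry.toLinearMap
    P.inv.one.lpIsometry.toLinearMap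
    (LinearMap.ext fun f => by
      have h := P.inv.one_inv
      rw [P.inv_inv] at h
      exact LabelRotation.lpIsometry_lpIsometry h f)
    (LinearMap.ext fun f => LabelRotation.lpIsometry_lpIsometry P.one_inv f)
  norm_map' f := P.one.lpIsometry.norm_map f

theorem coeFn_W (f : OnePhoton) : P.W f =ᵐ[modeMeasure] P.one.app f := P.one.coeFn_lpIsometry f

theorem isPhotonRotation_W : IsPhotonRotation P.T P.W :=
  ⟨P.B, P.measurable_B, P.unitary_B, fun f => P.coeFn_W f⟩

/-- The matrix is a tensor product with the same field `B` in each factor, so permuting the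
arguments amounts to permuting the summation labels. -/
theorem many_app_perm {n : ℕ} {f : (Fin n → Mode) → ℂ} (σ : Equiv.Perm (Fin n))
    (hf : ∀ᵐ x ∂nMeasure n, f (x ∘ σ) = f x) :
    ∀ᵐ x ∂nMeasure n, (P.many n).app f (x ∘ σ) = (P.many n).app f x := by
  filter_upwards [(P.many n).ae_R hf] with x hx
  unfold LabelRotation.app
  rw [← Equiv.sum_comp (Equiv.arrowCongr σ.symm (Equiv.refl (Fin 2)))]
  refine Finset.sum_congr rfl fun r _ => ?_
  rw [← hx r]
  congr 1
  exact Equiv.prod_comp σ fun i => P.B (x i).1 (x i).2 (r i)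

theorem lpIsometry_mem_Sector {n : ℕ} {f : Lp ℂ 2 (nMeasure n)} (hf : f ∈ Sector n) :
    (P.many n).lpIsometry f ∈ Sector n := by
  rw [mem_Sector_iff] at hf ⊢
  intro σ
  have h := (P.many n).coeFn_lpIsometry f
  filter_upwards [h, (measurePreserving_perm σ).quasiMeasurePreserving.ae h,
    P.many_app_perm σ (hf σ)] with x h1 h2 h3
  rw [h1, h2, h3]

/-- The rotation as a unitary operator on the `n`-photon space. -/
def sector (n : ℕ) : Sector n ≃ₗᵢ[ℂ] Sector n where
  toLinearEquiv := LinearEquiv.ofLinearMap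
    ((P.many n).lpIsometry.toLinearMap.restrict fun _ hf => P.lpIsometry_mem_Sector hf)
    ((P.inv.many n).lpIsometry.toLinearMap.restrict fun _ hf => P.inv.lpIsometry_mem_Sector hf)
    (LinearMap.ext fun f => Subtype.ext <| by
      have h := P.inv.many_inv n
      rw [P.inv_inv] at h
      exact LabelRotation.lpIsometry_lpIsometry h f.1)
    (LinearMap.ext fun f => Subtype.ext <| LabelRotation.lpIsometry_lpIsometry (P.many_inv n) f.1)
  norm_map' f := (P.many n).lpIsometry.norm_map f.1

end RotationData

/-- The Hilbert sum of unitary operators. -/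
def lpCongr {E : ℕ → Type*} [∀ n, NormedAddCommGroup (E n)] [∀ n, NormedSpace ℂ (E n)]
    (V : ∀ n, E n ≃ₗᵢ[ℂ] E n) : lp E 2 ≃ₗᵢ[ℂ] lp E 2 where
  toFun ψ := ⟨fun n => V n (ψ n), memℓp_gen <| by
    simpa only [LinearIsometryEquiv.norm_map] using (lp.memℓp ψ).summable (by simp)⟩
  invFun ψ := ⟨fun n => (V n).symm (ψ n), memℓp_gen <| by
    simpa only [LinearIsometryEquiv.norm_map] using (lp.memℓp ψ).summable (by simp)⟩
  map_add' ψ φ := lp.ext (funext fun n => map_add (V n) _ _)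
  map_smul' c ψ := lp.ext (funext fun n => map_smul (V n) c _)
  left_inv ψ := lp.ext (funext fun n => (V n).symm_apply_apply _)
  right_inv ψ := lp.ext (funext fun n => (V n).apply_symm_apply _)
  norm_map' ψ := by
    rw [lp.norm_eq_tsum_rpow (by simp), lp.norm_eq_tsum_rpow (by simp)]
    congr 1
    exact tsum_congr fun n => by
      change ‖V n (ψ n)‖ ^ _ = _
      rw [LinearIsometryEquiv.norm_map]

namespace RotationData

variable (P : RotationData)

/-- The second quantization of the rotation. -/
def G : Fock ≃ₗᵢ[ℂ] Fock := lpCongr P.sector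

theorem G_symm_apply (ψ : Fock) : P.G.symm ψ = P.inv.G ψ := rfl

theorem comp_G (ψ : Fock) (n : ℕ) :
    ∀ᵐ x ∂nMeasure n, comp (P.G ψ) n x = (P.many n).app (comp ψ n) x :=
  (P.many n).coeFn_lpIsometry (ψ n : Lp ℂ 2 (nMeasure n))

theorem many_app_prod (f : Mode → ℂ) {n : ℕ} (x : Fin n → Mode) :
    (P.many n).app (fun x => ∏ i, f (x i)) x = ∏ i, P.one.app f (x i) := by
  simp only [LabelRotation.app, Finset.prod_univ_sum, Fintype.piFinset_univ]
  exact Finset.sum_congr rfl fun r _ => Finset.prod_mul_distrib.symm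

theorem isSecondQuantization_G : IsSecondQuantization P.W P.G := by
  refine ⟨fun n ψ h => ?_, fun n f ψ h => ?_⟩
  · change P.sector n (ψ n) = 0
    rw [h, map_zero]
  · filter_upwards [P.comp_G ψ n, (P.many n).app_congr h, ae_nMeasure_of_ae (P.coeFn_W f) n]
      with x h1 h2 h3
    rw [h1, h2, many_app_prod]
    simp only [h3]

/-- `B` mixes polarizations only, hence commutes with multiplication by functions of the momenta;
what remains is the change of variables `k ↦ T⁻¹k`. -/
theorem dGamma_graph_G {h : R3 → ℝ} {ψ φ : Fock} (hz : (ψ, φ) ∈ (dGamma h).graph) :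
    (P.G ψ, P.G φ) ∈ (dGamma fun k => h (act P.T.transpose k)).graph := by
  rw [mem_dGamma_graph] at hz ⊢
  intro n
  filter_upwards [P.comp_G ψ n, P.comp_G φ n, (P.many n).ae_R (hz n)] with x h1 h2 h3
  rw [h1, h2]
  simp only [LabelRotation.app, h3, Finset.mul_sum]
  refine Finset.sum_congr rfl fun r _ => ?_
  have : ∑ i, h ((P.many n).R r x i).1 = ∑ i, h (act P.T.transpose (x i).1) := rfl
  rw [this]
  ring

/-- The transformation is a tensor power, so it acts separately on the `i`-th photon and on the
others. Summing over each summand of `a(f)*` gives `Γ(W) a(f)* Γ(W)⁻¹ = a(Wf)*`. -/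
theorem many_app_creation (f : Mode → ℂ) {n : ℕ} (F : (Fin n → Mode) → ℂ) (i : Fin (n + 1))
    (x : Fin (n + 1) → Mode) :
    (P.many (n + 1)).app (fun x => f (x i) * F (x ∘ i.succAbove)) x
      = P.one.app f (x i) * (P.many n).app F (x ∘ i.succAbove) := by
  unfold LabelRotation.app
  -- A label of `n + 1` photons is split into the label `a` of the `i`-th photon and the labels `s`
  -- of the others.
  rw [← Equiv.sum_comp (Fin.insertNthEquiv (fun _ => Fin 2) i), Fintype.sum_prod_type,
    Finset.sum_mul_sum]
  refine Finset.sum_congr rfl fun a _ => Finset.sum_congr rfl fun s _ => ?_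
  have h1 : (P.many (n + 1)).M x ((P.many (n + 1)).label x)
      (Fin.insertNthEquiv (fun _ => Fin 2) i (a, s))
      = P.one.M (x i) (P.one.label (x i)) a * (P.many n).M (x ∘ i.succAbove)
        ((P.many n).label (x ∘ i.succAbove)) s := by
    change ∏ j, P.B (x j).1 (x j).2 (i.insertNth (α := fun _ => Fin 2) a s j)
      = P.B (x i).1 (x i).2 a
        * ∏ j, P.B (x (i.succAbove j)).1 (x (i.succAbove j)).2 (s j)
    rw [Fin.prod_univ_succAbove _ i]
    simp only [Fin.insertNth_apply_same, Fin.insertNth_apply_succAbove]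
  have h2 : (P.many (n + 1)).R (Fin.insertNthEquiv (fun _ => Fin 2) i (a, s)) x i
      = P.one.R a (x i) := by
    change (act P.T.transpose (x i).1, i.insertNth (α := fun _ => Fin 2) a s i) = _
    rw [Fin.insertNth_apply_same]
    rfl
  have h3 : (P.many (n + 1)).R (Fin.insertNthEquiv (fun _ => Fin 2) i (a, s)) x ∘ i.succAbove
      = (P.many n).R s (x ∘ i.succAbove) := by
    funext j
    change (act P.T.transpose (x (i.succAbove j)).1,
      i.insertNth (α := fun _ => Fin 2) a s (i.succAbove j)) = _
    rw [Fin.insertNth_apply_succAbove]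
    rfl
  rw [h1]
  beta_reduce
  rw [h2, h3]
  ring

theorem creation_graph_G {f : Mode → ℂ} {ψ φ : Fock} (hz : (ψ, φ) ∈ (creation f).graph) :
    (P.G ψ, P.G φ) ∈ (creation (P.one.app f)).graph := by
  rw [mem_creation_graph] at hz ⊢
  refine ⟨P.isSecondQuantization_G.1 0 φ hz.1, fun n => ?_⟩
  have h4 : ∀ᵐ x ∂nMeasure (n + 1), ∀ i : Fin (n + 1),
      comp (P.G ψ) n (x ∘ i.succAbove) = (P.many n).app (comp ψ n) (x ∘ i.succAbove) :=
    ae_all_iff.2 fun i => (quasiMeasurePreserving_remove i).ae (P.comp_G ψ n)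
  filter_upwards [P.comp_G φ (n + 1), (P.many (n + 1)).ae_R (hz.2 n), h4] with x h1 h2 h3
  rw [h1]
  simp only [h3, ← many_app_creation]
  simp only [LabelRotation.app, h2, Finset.mul_sum]
  rw [Finset.sum_comm]
  exact Finset.sum_congr rfl fun r _ => Finset.sum_congr rfl fun i _ => by ring

/-- Obtained by duality: `Γ(W)⁻¹` carries `a(Wf)*` back to `a(f)*`, and inner products are
preserved. -/
theorem annihilation_graph_G {f : Mode → ℂ} (hf : MemLp f 2 modeMeasure) {ψ φ : Fock}
    (hz : (ψ, φ) ∈ (annihilation f).graph) :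
    (P.G ψ, P.G φ) ∈ (annihilation (P.one.app f)).graph := by
  rw [mem_annihilation_graph hf] at hz
  rw [mem_annihilation_graph (P.one.memLp_app hf)]
  intro η ζ hη
  have h := P.inv.creation_graph_G hη
  rw [LabelRotation.app_app P.one_inv] at h
  have h2 := hz _ _ h
  rw [← P.G_symm_apply, ← P.G_symm_apply] at h2
  rw [← P.G.symm.inner_map_map, ← P.G.symm.inner_map_map η, P.G.symm_apply_apply,
    P.G.symm_apply_apply, h2]

end RotationData

/-! ### Intertwining relations on the domain of `dΓ(h)` -/

theorem dGamma_graph_sum {ι : Type*} [Fintype ι] (t : ι → ℝ) (h : ι → R3 → ℝ) {ψ : Fock}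
    {φ : ι → Fock} (hφ : ∀ i, (ψ, φ i) ∈ (dGamma (h i)).graph) :
    (ψ, ∑ i, (t i : ℂ) • φ i) ∈ (dGamma fun k => ∑ i, t i * h i k).graph := by
  simp only [mem_dGamma_graph] at hφ ⊢
  intro n
  filter_upwards [comp_sum Finset.univ (fun i => (t i : ℂ) • φ i) n,
    ae_all_iff.2 fun i => comp_smul (t i : ℂ) (φ i) n, ae_all_iff.2 fun i => hφ i n]
    with x h1 h2 h3
  rw [h1]
  simp only [h2, h3]
  rw [Finset.sum_comm]
  simp only [Complex.ofReal_sum, Complex.ofReal_mul, Finset.mul_sum, Finset.sum_mul]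
  exact Finset.sum_congr rfl fun i _ => Finset.sum_congr rfl fun j _ => by ring

theorem G_momentum_eq (P : RotationData) {ψ k : Fock} {K : Fin 3 → Fock} {j : Fin 3}
    (hk : (ψ, k) ∈ (dGamma fun k => k j).graph)
    (hK : ∀ i, (P.G ψ, K i) ∈ (dGamma fun k => k i).graph) :
    P.G k = ∑ i, ((P.T i j : ℝ) : ℂ) • K i :=
  LinearPMap.mem_graph_snd_inj _ (P.dGamma_graph_G hk)
    (dGamma_graph_sum (fun i => P.T i j) (fun i k => k i) hK) rfl

/-- The closure extends the algebraic sum and is single-valued, so on the domain of `dΓ(h)` it has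
no other value. -/
theorem mem_segalField_graph_unique {h : R3 → ℝ} {f : Mode → ℂ} (hf : Admissible h f)
    {ψ : Fock} (hψ : ψ ∈ (dGamma h).domain) :
    ∃ b c, (ψ, b) ∈ (annihilation f).graph ∧ (ψ, c) ∈ (creation f).graph ∧
      ∀ v, (ψ, v) ∈ (segalField f).graph ↔ v = ((Real.sqrt 2)⁻¹ : ℂ) • (b + c) := by
  obtain ⟨b, hb⟩ := LinearPMap.mem_domain_iff.1 (dGamma_domain_le_annihilation hf hψ)
  obtain ⟨c, hc⟩ := LinearPMap.mem_domain_iff.1 (dGamma_domain_le_creation hf hψ)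
  refine ⟨b, c, hb, hc, fun v => ⟨fun hv => ?_, fun hv => hv ▸ mem_segalField_graph hb hc⟩⟩
  exact LinearPMap.mem_graph_snd_inj _ hv (mem_segalField_graph hb hc) rfl

/-- `Γ(W)` turns the coupling `gⱼ` into `W gⱼ = ∑ᵢ Tᵢⱼ gᵢ`, and on the domain of `dΓ(h)` creation
and annihilation parts are both real-linear in the coupling. -/
theorem G_segalField_eq (P : RotationData) {h : R3 → ℝ} {g : Fin 3 → Mode → ℂ}
    (hg : ∀ j, Admissible h (g j)) {j : Fin 3}
    (hrot : P.one.app (g j) =ᵐ[modeMeasure] fun x => ∑ i, ((P.T i j : ℝ) : ℂ) * g i x)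
    {ψ v : Fock} (hψ : ψ ∈ (dGamma h).domain) (hGψ : P.G ψ ∈ (dGamma h).domain)
    {A : Fin 3 → Fock} (hv : (ψ, v) ∈ (segalField (g j)).graph)
    (hA : ∀ i, (P.G ψ, A i) ∈ (segalField (g i)).graph) :
    P.G v = ∑ i, ((P.T i j : ℝ) : ℂ) • A i := by
  obtain ⟨b, c, hb, hc, huniq⟩ := mem_segalField_graph_unique (hg j) hψ
  choose b' c' hb' hc' huniq' using fun i => mem_segalField_graph_unique (hg i) hGψ
  have hGb := P.annihilation_graph_G (hg j).memLp hb
  have hGc := P.creation_graph_G hc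
  rw [annihilation_congr hrot] at hGb
  rw [creation_graph_congr hrot] at hGc
  have eb := annihilation_graph_sum (fun i => P.T i j) (fun i => (hg i).memLp) hb' hGb
  have ec := LinearPMap.mem_graph_snd_inj _ hGc
    (creation_graph_sum (fun i => P.T i j) g hc') rfl
  rw [(huniq v).1 hv, map_smul, map_add, eb, ec, ← Finset.sum_add_distrib, Finset.smul_sum]
  refine Finset.sum_congr rfl fun i _ => ?_
  rw [(huniq' i (A i)).1 (hA i), ← smul_add, smul_comm]

/-! ### The polarization rotation -/

section Polarization

variable {e : Fin 2 → R3 → R3}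

/-- The two polarization vectors and `k/‖k‖` form an orthonormal basis of `ℝ³`, in which `v` has no
component along `k`. -/
theorem IsPolarization.expand (he : IsPolarization e) {k v : R3} (hk : k ≠ 0)
    (hv : ⟪v, k⟫_ℝ = 0) : ∑ r, ⟪e r k, v⟫_ℝ • e r k = v := by
  let b : Fin 3 → R3 := ![e 0 k, e 1 k, (‖k‖⁻¹ : ℝ) • k]
  have hn : ‖k‖ ≠ 0 := norm_ne_zero_iff.2 hk
  have h00 := he.orthonormal k 0 0
  have h01 := he.orthonormal k 0 1
  have h10 := he.orthonormal k 1 0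
  have h11 := he.orthonormal k 1 1
  have t0 := he.transverse k 0
  have t1 := he.transverse k 1
  have t0' : ⟪k, e 0 k⟫_ℝ = 0 := by rw [real_inner_comm, t0]
  have t1' : ⟪k, e 1 k⟫_ℝ = 0 := by rw [real_inner_comm, t1]
  have hv' : ⟪k, v⟫_ℝ = 0 := by rw [real_inner_comm, hv]
  have hb : Orthonormal ℝ b := by
    rw [orthonormal_iff_ite]
    intro i j
    fin_cases i <;> fin_cases j <;>
      simp [b, inner_smul_left, inner_smul_right, h00, h01, h10, h11, t0, t1, t0', t1', hn, -inner_self_eq_norm_sq_to_K, real_inner_self_eq_norm_sq, pow_two]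
  let ob := OrthonormalBasis.mk hb
    (by rw [hb.linearIndependent.span_eq_top_of_card_eq_finrank' (by simp)])
  have h := ob.sum_repr' v
  simp only [ob, OrthonormalBasis.coe_mk, Fin.sum_univ_three] at h
  rw [Fin.sum_univ_two]
  simpa [b, inner_smul_left, hv'] using h

theorem IsPolarization.norm_eq (he : IsPolarization e) (l : Fin 2) (k : R3) : ‖e l k‖ = 1 := by
  have h := he.orthonormal k l l
  rw [real_inner_self_eq_norm_sq, if_pos rfl] at h
  exact (pow_eq_one_iff_of_nonneg (norm_nonneg _) two_ne_zero).1 h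

theorem IsPolarization.abs_apply_le (he : IsPolarization e) (l : Fin 2) (k : R3) (j : Fin 3) :
    |e l k j| ≤ 1 := by
  rw [← he.norm_eq l k]
  exact PiLp.norm_apply_le (e l k) j

/-- The transition matrix between the rotated and the given polarization vectors. -/
def transition (e : Fin 2 → R3 → R3) (T : Matrix (Fin 3) (Fin 3) ℝ) (k : R3) :
    Matrix (Fin 2) (Fin 2) ℂ :=
  fun l r => ((⟪e r (act T.transpose k), act T.transpose (e l k)⟫_ℝ : ℝ) : ℂ)

variable {T : Matrix (Fin 3) (Fin 3) ℝ}

theorem inner_act_act (hT : T ∈ Matrix.orthogonalGroup (Fin 3) ℝ) (v w : R3) :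
    ⟪act T v, act T w⟫_ℝ = ⟪v, w⟫_ℝ := by
  rw [inner_act_left, ← act_mul, transpose_mul_self hT, act_one]

theorem act_ne_zero (hT : T ∈ Matrix.orthogonalGroup (Fin 3) ℝ) {k : R3} (hk : k ≠ 0) :
    act T k ≠ 0 := by
  rw [← norm_ne_zero_iff, norm_act hT]
  exact norm_ne_zero_iff.2 hk

theorem IsPolarization.expand_act (he : IsPolarization e)
    (hT : T ∈ Matrix.orthogonalGroup (Fin 3) ℝ) {k : R3} (hk : k ≠ 0) (l : Fin 2) :
    ∑ r, ⟪e r (act T.transpose k), act T.transpose (e l k)⟫_ℝ • e r (act T.transpose k)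
      = act T.transpose (e l k) := by
  have hTt := transpose_mem_orthogonalGroup hT
  exact he.expand (act_ne_zero hTt hk) (by rw [inner_act_act hTt, he.transverse])

/-- The entries are the coefficients of the orthonormal vectors `T⁻¹e⁽ˡ⁾(k)` in the orthonormal
frame at `T⁻¹k`, so the product is their Gram matrix. -/
theorem transition_mul_star (he : IsPolarization e)
    (hT : T ∈ Matrix.orthogonalGroup (Fin 3) ℝ) {k : R3} (hk : k ≠ 0) :
    transition e T k * star (transition e T k) = 1 := by
  ext l l'
  have h : ⟪act T.transpose (e l k), act T.transpose (e l' k)⟫_ℝ = if l = l' then 1 else 0 := by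
    rw [inner_act_act (transpose_mem_orthogonalGroup hT), he.orthonormal]
  rw [← he.expand_act hT hk l, sum_inner] at h
  simp only [inner_smul_left, conj_trivial] at h
  rw [Matrix.mul_apply, Matrix.one_apply]
  simp only [Matrix.star_apply, transition, RCLike.star_def, Complex.conj_ofReal,
    ← Complex.ofReal_mul, ← Complex.ofReal_sum]
  rw [h]
  split_ifs <;> simp

/-- The phase `ρ(k) / ρ(T⁻¹k)`, where it makes sense. -/
def phase (ρ : R3 → ℂ) (T : Matrix (Fin 3) (Fin 3) ℝ) (k : R3) : ℂ :=
  if ρ (act T.transpose k) ≠ 0 ∧ ‖ρ k‖ = ‖ρ (act T.transpose k)‖ then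
    ρ k / ρ (act T.transpose k) else 1

theorem norm_phase (ρ : R3 → ℂ) (k : R3) : ‖phase ρ T k‖ = 1 := by
  unfold phase
  split_ifs with h
  · rw [norm_div, h.2, div_self (norm_ne_zero_iff.2 h.1)]
  · exact norm_one

theorem phase_mul {ρ : R3 → ℂ} {k : R3} (h : ‖ρ k‖ = ‖ρ (act T.transpose k)‖) :
    phase ρ T k * ρ (act T.transpose k) = ρ k := by
  unfold phase
  split_ifs with h'
  · exact div_mul_cancel₀ _ h'.1
  · have h0 : ρ (act T.transpose k) = 0 := by
      by_contra h0
      exact h' ⟨h0, h⟩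
    rw [h0, norm_zero, norm_eq_zero] at h
    rw [h0, h, mul_zero]

theorem measurable_phase {ρ : R3 → ℂ} (hρ : Measurable ρ) : Measurable (phase ρ T) := by
  have h := hρ.comp (measurable_act T.transpose)
  refine Measurable.ite ?_ (hρ.div h) measurable_const
  exact (h (measurableSet_singleton 0).compl).inter (measurableSet_eq_fun hρ.norm h.norm)

theorem measurable_inner_transition (he : IsPolarization e) (l r : Fin 2) :
    Measurable fun k => transition e T k l r := by
  refine Complex.measurable_ofReal.comp ?_
  exact ((he.measurable r).comp (measurable_act _)).inner
    ((measurable_act _).comp (he.measurable l))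

/-- The transition matrix accounts for the polarization vectors, the phase for `ρ`, and `‖k‖^(-1/2)`
is invariant under `T`. -/
theorem exists_rotationData (he : IsPolarization e) {ρ : R3 → ℂ}
    (hρ : AEStronglyMeasurable ρ volume) (hT : T ∈ Matrix.orthogonalGroup (Fin 3) ℝ)
    (hsymm : ∀ᵐ k : R3, ‖ρ k‖ = ‖ρ (act T k)‖) :
    ∃ P : RotationData, P.T = T ∧ ∀ j, P.one.app (coupling ρ e j) =ᵐ[modeMeasure]
      fun x => ∑ i, ((T i j : ℝ) : ℂ) * coupling ρ e i x := by
  classical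
  have hTt := transpose_mem_orthogonalGroup hT
  -- `B` has to be measurable, while `ρ` is only almost everywhere equal to a measurable function.
  let ρ' := hρ.mk ρ
  let B : R3 → Matrix (Fin 2) (Fin 2) ℂ := fun k =>
    -- At `k = 0` transversality is void, and the transition matrix may fail to be unitary.
    if k = 0 then 1 else phase ρ' T k • transition e T k
  have hB : ∀ l r, Measurable fun k => B k l r := by
    intro l r
    have : (fun k => B k l r) = fun k =>
        if k = 0 then (1 : Matrix (Fin 2) (Fin 2) ℂ) l r else phase ρ' T k * transition e T k l r := by
      funext k
      simp only [B]
      split_ifs <;> rfl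
    rw [this]
    exact Measurable.ite (measurableSet_singleton 0) measurable_const
      ((measurable_phase hρ.stronglyMeasurable_mk.measurable).mul
        (measurable_inner_transition he l r))
  have hBu : ∀ k, B k ∈ Matrix.unitaryGroup (Fin 2) ℂ := by
    intro k
    by_cases hk : k = 0
    · simp only [B, hk, if_true]
      exact one_mem _
    · simp only [B, hk, if_false]
      rw [Matrix.mem_unitaryGroup_iff, star_smul, Matrix.smul_mul, Matrix.mul_smul,
        transition_mul_star he hT hk, smul_smul, RCLike.star_def, Complex.mul_conj',
        norm_phase]
      simp
  refine ⟨⟨T, hT, B, hB, hBu⟩, rfl, fun j => ?_⟩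
  have h0 : ∀ᵐ k : R3, k ≠ 0 := compl_mem_ae_iff.2 (measure_singleton 0)
  have hmp := (measurePreserving_act hTt).quasiMeasurePreserving
  filter_upwards [ae_modeMeasure_of_ae h0, ae_modeMeasure_of_ae hρ.ae_eq_mk,
    ae_modeMeasure_of_ae (hmp.ae hρ.ae_eq_mk), ae_modeMeasure_of_ae (hmp.ae hsymm)]
    with x hx0 hx1 hx2 hx3
  obtain ⟨k, l⟩ := x
  simp only at hx0 hx1 hx2 hx3
  -- The symmetry of `‖ρ‖` was evaluated at `T⁻¹k`, which gives `‖ρ(T⁻¹k)‖ = ‖ρ(k)‖`.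
  rw [← act_mul, mul_transpose_self hT, act_one] at hx3
  replace hx1 : ρ k = ρ' k := hx1
  replace hx2 : ρ (act T.transpose k) = ρ' (act T.transpose k) := hx2
  have hph : phase ρ' T k * ρ (act T.transpose k) = ρ k := by
    rw [hx2, phase_mul, ← hx1]
    rw [← hx1, ← hx2, hx3]
  have hexp := congrArg (fun v : R3 => v j) (he.expand_act hT hx0 l)
  simp only [WithLp.ofLp_sum, Finset.sum_apply, PiLp.smul_apply, smul_eq_mul] at hexp
  rw [act_apply T.transpose] at hexp
  simp only [Matrix.transpose_apply] at hexp
  have hexp' := congrArg (fun y : ℝ => (y : ℂ)) hexp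
  simp only [Complex.ofReal_sum, Complex.ofReal_mul] at hexp'
  change ∑ r, B k l r * ((((‖act T.transpose k‖ ^ (-(1 / 2) : ℝ) : ℝ) : ℂ)
    * ρ (act T.transpose k)) * ((e r (act T.transpose k) j : ℝ) : ℂ))
    = ∑ i, ((T i j : ℝ) : ℂ) * ((((‖k‖ ^ (-(1 / 2) : ℝ) : ℝ) : ℂ) * ρ k)
      * ((e l k i : ℝ) : ℂ))
  rw [norm_act hTt, ← hph]
  have hBk : ∀ r, B k l r = phase ρ' T k * transition e T k l r := by
    intro r
    simp only [B, hx0, if_false]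
    rfl
  simp only [hBk, transition]
  generalize ((‖k‖ ^ (-(1 / 2) : ℝ) : ℝ) : ℂ) = c
  calc _ = c * (phase ρ' T k * ρ (act T.transpose k)) *
        ∑ r, ((⟪e r (act T.transpose k), act T.transpose (e l k)⟫_ℝ : ℝ) : ℂ)
          * ((e r (act T.transpose k) j : ℝ) : ℂ) := by
        rw [Finset.mul_sum]
        exact Finset.sum_congr rfl fun r _ => by ring
    _ = _ := by
        rw [hexp', Finset.mul_sum]
        exact Finset.sum_congr rfl fun r _ => by ring

/-! ### Admissibility of the coupling functions -/

theorem measurable_omega (m : ℝ) : Measurable (omega m) := by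
  unfold omega
  fun_prop

theorem norm_le_omega {m : ℝ} (hm : 0 ≤ m) (k : R3) : ‖k‖ ≤ omega m k := by
  unfold omega
  nlinarith [norm_nonneg k, mul_nonneg hm (norm_nonneg k)]

theorem aestronglyMeasurable_coupling (he : IsPolarization e) {ρ : R3 → ℂ}
    (hρ : AEStronglyMeasurable ρ volume) (j : Fin 3) :
    AEStronglyMeasurable (coupling ρ e j) modeMeasure := by
  unfold coupling
  refine AEStronglyMeasurable.mul (AEStronglyMeasurable.mul ?_ ?_) ?_
  · refine Measurable.aestronglyMeasurable ?_
    fun_prop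
  · exact hρ.comp_quasiMeasurePreserving Measure.quasiMeasurePreserving_fst
  · refine (Complex.measurable_ofReal.comp ?_).aestronglyMeasurable
    refine measurable_from_prod_countable_left fun l => ?_
    exact (EuclideanSpace.proj (𝕜 := ℝ) j).continuous.measurable.comp (he.measurable l)

/-- With `t = ‖k‖^(-1/2)`, the bound `t ≤ 1 + t²` places `gⱼ` between the two integrability
hypotheses on `ρ`. Since `ω_m ≥ ‖k‖`, the weighted function is dominated by `‖k‖⁻¹|ρ|`. -/
theorem admissible_coupling (he : IsPolarization e) {ρ : R3 → ℂ} (hρ : MemLp ρ 2 volume)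
    (hρ' : MemLp (fun k => ((‖k‖⁻¹ : ℝ) : ℂ) * ρ k) 2 volume) {m : ℝ} (hm : 0 ≤ m) (j : Fin 3) :
    Admissible (omega m) (coupling ρ e j) := by
  have hmeas := aestronglyMeasurable_coupling he hρ.1 j
  have h1 : MemLp (fun x : Mode => ρ x.1) 2 modeMeasure := hρ.comp_fst _
  have h2 : MemLp (fun x : Mode => ((‖x.1‖⁻¹ : ℝ) : ℂ) * ρ x.1) 2 modeMeasure := hρ'.comp_fst _
  have hrp : ∀ k : R3, ‖k‖ ^ (-(1 / 2) : ℝ) = (Real.sqrt ‖k‖)⁻¹ := fun k => by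
    rw [Real.rpow_neg (norm_nonneg _), Real.sqrt_eq_rpow]
  have hnorm : ∀ x : Mode, ‖coupling ρ e j x‖ ≤ (Real.sqrt ‖x.1‖)⁻¹ * ‖ρ x.1‖ := by
    intro x
    simp only [coupling, norm_mul, Complex.norm_real, hrp, norm_inv, Real.norm_eq_abs,
      abs_of_nonneg (Real.sqrt_nonneg _)]
    exact mul_le_of_le_one_right (by positivity) (he.abs_apply_le _ _ _)
  have hsq : ∀ k : R3, (Real.sqrt ‖k‖)⁻¹ * (Real.sqrt ‖k‖)⁻¹ = ‖k‖⁻¹ := fun k => by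
    rw [← mul_inv, Real.mul_self_sqrt (norm_nonneg _)]
  refine ⟨measurable_omega m, ?_, ?_, ?_⟩
  · have h0 : ∀ᵐ k : R3, k ≠ 0 := compl_mem_ae_iff.2 (measure_singleton 0)
    filter_upwards [h0] with k hk
    exact (norm_pos_iff.2 hk).trans_le (norm_le_omega hm k)
  · refine (h1.norm.add h2.norm).of_le hmeas (Filter.Eventually.of_forall fun x => ?_)
    refine (hnorm x).trans ((?_ : _ ≤ _).trans (le_abs_self _))
    rw [Pi.add_apply, norm_mul, Complex.norm_real, norm_inv, norm_norm, ← hsq]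
    have h0 : 0 ≤ (Real.sqrt ‖x.1‖)⁻¹ := by positivity
    generalize (Real.sqrt ‖x.1‖)⁻¹ = t at h0
    nlinarith [norm_nonneg (ρ x.1), mul_nonneg (norm_nonneg (ρ x.1)) (sq_nonneg (t - 1)),
      mul_nonneg (norm_nonneg (ρ x.1)) h0]
  · refine h2.of_le ?_ (Filter.Eventually.of_forall fun x => ?_)
    · refine AEStronglyMeasurable.mul (Measurable.aestronglyMeasurable ?_) hmeas
      exact Complex.measurable_ofReal.comp
        ((measurable_omega m).comp measurable_fst).sqrt.inv
    · rw [norm_mul, norm_mul, Complex.norm_real, Complex.norm_real, Real.norm_eq_abs,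
        Real.norm_eq_abs, abs_of_nonneg (by positivity), abs_of_nonneg (by positivity), ← hsq,
        mul_assoc]
      -- At `k = 0` the inverse of zero is zero by convention and the coupling vanishes; `inv_anti₀`
      -- needs `‖k‖ > 0`.
      rcases (norm_nonneg x.1).eq_or_lt with h0 | h0
      · have := hnorm x
        rw [← h0] at this ⊢
        simp only [Real.sqrt_zero, inv_zero, zero_mul] at this ⊢
        rw [le_antisymm this (norm_nonneg _), mul_zero]
      · refine mul_le_mul ?_ (hnorm x) (norm_nonneg _) (by positivity)
        exact inv_anti₀ (Real.sqrt_pos.2 h0) (Real.sqrt_le_sqrt (norm_le_omega hm _))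

end Polarization

/-! ### Graphs of sums of operators -/

section Graphs

variable {E F : Type*} [AddCommGroup E] [Module ℂ E] [AddCommGroup F] [Module ℂ F]

theorem mem_graph_add {f g : E →ₗ.[ℂ] F} {x : E} {y : F} :
    (x, y) ∈ (f + g).graph ↔ ∃ a b, (x, a) ∈ f.graph ∧ (x, b) ∈ g.graph ∧ y = a + b := by
  constructor
  · intro h
    obtain ⟨z, rfl, rfl⟩ := (LinearPMap.mem_graph_iff _).1 h
    exact ⟨_, _, f.mem_graph ⟨z, z.2.1⟩, g.mem_graph ⟨z, z.2.2⟩, rfl⟩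
  · rintro ⟨a, b, ha, hb, rfl⟩
    have h1 := LinearPMap.mem_domain_of_mem_graph ha
    have h2 := LinearPMap.mem_domain_of_mem_graph hb
    rw [(LinearPMap.image_iff h1).2 ha, (LinearPMap.image_iff h2).2 hb]
    exact (f + g).mem_graph ⟨x, h1, h2⟩

theorem mem_graph_smul {c : ℂ} {f : E →ₗ.[ℂ] F} {x : E} {y : F} :
    (x, y) ∈ (c • f).graph ↔ ∃ a, (x, a) ∈ f.graph ∧ y = c • a := by
  constructor
  · intro h
    obtain ⟨z, rfl, rfl⟩ := (LinearPMap.mem_graph_iff _).1 h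
    exact ⟨_, f.mem_graph z, rfl⟩
  · rintro ⟨a, ha, rfl⟩
    have h1 := LinearPMap.mem_domain_of_mem_graph ha
    rw [(LinearPMap.image_iff h1).2 ha]
    exact (c • f).mem_graph ⟨x, h1⟩

theorem mem_graph_sub {f g : E →ₗ.[ℂ] F} {x : E} {y : F} :
    (x, y) ∈ (f - g).graph ↔ ∃ a b, (x, a) ∈ f.graph ∧ (x, b) ∈ g.graph ∧ y = a - b := by
  constructor
  · intro h
    obtain ⟨z, rfl, rfl⟩ := (LinearPMap.mem_graph_iff _).1 h
    exact ⟨_, _, f.mem_graph ⟨z, z.2.1⟩, g.mem_graph ⟨z, z.2.2⟩, rfl⟩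
  · rintro ⟨a, b, ha, hb, rfl⟩
    have h1 := LinearPMap.mem_domain_of_mem_graph ha
    have h2 := LinearPMap.mem_domain_of_mem_graph hb
    rw [(LinearPMap.image_iff h1).2 ha, (LinearPMap.image_iff h2).2 hb]
    exact (f - g).mem_graph ⟨x, h1, h2⟩

theorem mem_graph_sum_three {f : Fin 3 → E →ₗ.[ℂ] F} {x : E} {y : F} :
    (x, y) ∈ (∑ j, f j).graph ↔ ∃ a : Fin 3 → F, (∀ j, (x, a j) ∈ (f j).graph) ∧ y = ∑ j, a j := by
  rw [Fin.sum_univ_three, mem_graph_add]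
  simp only [mem_graph_add]
  constructor
  · rintro ⟨_, c, ⟨a, b, ha, hb, rfl⟩, hc, rfl⟩
    refine ⟨![a, b, c], fun j => ?_, by simp [Fin.sum_univ_three]⟩
    fin_cases j
    exacts [ha, hb, hc]
  · rintro ⟨a, ha, rfl⟩
    exact ⟨_, a 2, ⟨a 0, a 1, ha 0, ha 1, rfl⟩, ha 2, Fin.sum_univ_three a⟩

end Graphs

/-! ### Matrices acting on tuples of vectors -/

section MatAct

variable {F : Type*} [NormedAddCommGroup F] [InnerProductSpace ℂ F]

/-- The action of a `4 × 4` matrix on 4-tuples of vectors. -/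
def matAct (C : Matrix (Fin 4) (Fin 4) ℂ) : (Fin 4 → F) →ₗ[ℂ] (Fin 4 → F) where
  toFun x s := ∑ t, C s t • x t
  map_add' x y := by
    funext s
    simp only [Pi.add_apply, smul_add, Finset.sum_add_distrib]
  map_smul' c x := by
    funext s
    simp only [Pi.smul_apply, RingHom.id_apply, Finset.smul_sum]
    exact Finset.sum_congr rfl fun t _ => smul_comm _ _ _

theorem matAct_apply (C : Matrix (Fin 4) (Fin 4) ℂ) (x : Fin 4 → F) (s : Fin 4) :
    matAct C x s = ∑ t, C s t • x t := rfl

theorem matAct_one (x : Fin 4 → F) : matAct 1 x = x := by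
  funext s
  simp [matAct_apply, Matrix.one_apply, ite_smul]

theorem matAct_mul (C D : Matrix (Fin 4) (Fin 4) ℂ) (x : Fin 4 → F) :
    matAct (C * D) x = matAct C (matAct D x) := by
  funext s
  simp only [matAct_apply, Matrix.mul_apply, Finset.sum_smul, Finset.smul_sum, smul_smul]
  rw [Finset.sum_comm]

theorem matAct_sum_smul {ι : Type*} [Fintype ι] (c : ι → ℂ)
    (C : ι → Matrix (Fin 4) (Fin 4) ℂ) (x : Fin 4 → F) :
    matAct (∑ i, c i • C i) x = ∑ i, c i • matAct (C i) x := by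
  funext s
  simp only [matAct_apply, Finset.sum_apply, Pi.smul_apply, Matrix.sum_apply, Matrix.smul_apply,
    Finset.sum_smul, Finset.smul_sum, smul_assoc]
  rw [Finset.sum_comm]

theorem map_matAct (G : F →ₗ[ℂ] F) (C : Matrix (Fin 4) (Fin 4) ℂ) (x : Fin 4 → F) :
    (fun s => G (matAct C x s)) = matAct C fun t => G (x t) := by
  funext s
  simp only [matAct_apply, map_sum, map_smul]

theorem sum_norm_sq_matAct {u : Matrix (Fin 4) (Fin 4) ℂ} (hu : star u * u = 1)
    (x : Fin 4 → F) : ∑ s, ‖matAct u x s‖ ^ 2 = ∑ s, ‖x s‖ ^ 2 := by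
  have h : ∑ s, ⟪matAct u x s, matAct u x s⟫_ℂ = ∑ s, ⟪x s, x s⟫_ℂ := by
    have h1 : ∀ s, ⟪matAct u x s, matAct u x s⟫_ℂ
        = ∑ t, ∑ r, (star u t s * u s r) * ⟪x t, x r⟫_ℂ := by
      intro s
      simp only [matAct_apply, sum_inner, inner_sum, inner_smul_left, inner_smul_right,
        Matrix.star_apply, RCLike.star_def, Finset.mul_sum]
      rw [Finset.sum_comm]
      exact Finset.sum_congr rfl fun t _ => Finset.sum_congr rfl fun r _ => by ring
    have h2 : ∀ t r, ∑ s, (star u t s * u s r) * ⟪x t, x r⟫_ℂ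
        = if t = r then ⟪x t, x r⟫_ℂ else 0 := by
      intro t r
      rw [← Finset.sum_mul, ← Matrix.mul_apply, hu, Matrix.one_apply]
      split_ifs <;> simp
    simp only [h1]
    rw [Finset.sum_comm]
    refine Finset.sum_congr rfl fun t _ => ?_
    rw [Finset.sum_comm]
    simp only [h2, Finset.sum_ite_eq, Finset.mem_univ, if_true]
  simp only [inner_self_eq_norm_sq_to_K] at h
  exact_mod_cast h

theorem mem_graph_tensorOp {C : Matrix (Fin 4) (Fin 4) ℂ} {B : F →ₗ.[ℂ] F}
    {Ψ Φ : PiLp 2 fun _ : Fin 4 => F} :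
    (Ψ, Φ) ∈ (tensorOp C B).graph ↔
      ∃ w : Fin 4 → F, (∀ t, (Ψ t, w t) ∈ B.graph) ∧ Φ = WithLp.toLp 2 (matAct C w) := by
  constructor
  · intro h
    obtain ⟨z, rfl, rfl⟩ := (LinearPMap.mem_graph_iff _).1 h
    exact ⟨fun t => B ⟨z.1 t, z.2 t⟩, fun t => B.mem_graph ⟨z.1 t, z.2 t⟩, rfl⟩
  · rintro ⟨w, hw, rfl⟩
    have h1 : ∀ t, Ψ t ∈ B.domain := fun t => LinearPMap.mem_domain_of_mem_graph (hw t)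
    have h2 : w = fun t => B ⟨Ψ t, h1 t⟩ := funext fun t =>
      ((LinearPMap.image_iff (h1 t)).2 (hw t))
    rw [h2]
    exact (tensorOp C B).mem_graph ⟨Ψ, h1⟩

/-- The unitary operator `u ⊗ G` on tuples. -/
def tensorUnitary (u : Matrix (Fin 4) (Fin 4) ℂ) (hu : u ∈ Matrix.unitaryGroup (Fin 4) ℂ)
    (G : F ≃ₗᵢ[ℂ] F) : PiLp 2 (fun _ : Fin 4 => F) ≃ₗᵢ[ℂ] PiLp 2 (fun _ : Fin 4 => F) where
  toFun Ψ := WithLp.toLp 2 (matAct u fun t => G (Ψ t))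
  invFun Ψ := WithLp.toLp 2 fun s => G.symm (matAct (star u) Ψ.ofLp s)
  map_add' Ψ Φ := by
    ext s
    simp only [matAct_apply, PiLp.add_apply, map_add, smul_add, Finset.sum_add_distrib]
  map_smul' c Ψ := by
    ext s
    simp only [matAct_apply, PiLp.smul_apply, map_smul, RingHom.id_apply, Finset.smul_sum]
    exact Finset.sum_congr rfl fun t _ => smul_comm _ _ _
  left_inv Ψ := by
    ext s
    simp only [← matAct_mul, Matrix.mem_unitaryGroup_iff'.1 hu, matAct_one,
      G.symm_apply_apply]
  right_inv Ψ := by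
    ext s
    simp only [G.apply_symm_apply, ← matAct_mul, Matrix.mem_unitaryGroup_iff.1 hu, matAct_one]
  norm_map' Ψ := by
    rw [← sq_eq_sq₀ (norm_nonneg _) (norm_nonneg _), PiLp.norm_sq_eq_of_L2, PiLp.norm_sq_eq_of_L2]
    refine (sum_norm_sq_matAct (Matrix.mem_unitaryGroup_iff'.1 hu) fun t => G (Ψ t)).trans ?_
    simp only [LinearIsometryEquiv.norm_map]

theorem apply_eq_symm_matAct (u : Matrix (Fin 4) (Fin 4) ℂ)
    (hu : u ∈ Matrix.unitaryGroup (Fin 4) ℂ) (G : F ≃ₗᵢ[ℂ] F)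
    (Ψ : PiLp 2 fun _ : Fin 4 => F) (t : Fin 4) :
    Ψ t = G.symm (matAct (star u) (tensorUnitary u hu G Ψ).ofLp t) :=
  (congrFun (congrArg WithLp.ofLp ((tensorUnitary u hu G).symm_apply_apply Ψ)) t).symm

end MatAct

/-! ### The Hamiltonian -/

section Hamiltonian

variable {α : Fin 3 → Matrix (Fin 4) (Fin 4) ℂ} {β : Matrix (Fin 4) (Fin 4) ℂ}
  {e : Fin 2 → R3 → R3} {ρ : R3 → ℂ} {M q m : ℝ} {p : R3}

theorem mem_graph_hamiltonian {Ψ Φ : Fibre} :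
    (Ψ, Φ) ∈ (hamiltonian α β e ρ M q m p).graph ↔
      ∃ (w : Fin 4 → Fock) (k v : Fin 3 → Fin 4 → Fock),
        (∀ t, (Ψ t, w t) ∈ (dGamma (omega m)).graph) ∧
        (∀ j t, (Ψ t, k j t) ∈ (dGamma fun k => k j).graph) ∧
        (∀ j t, (Ψ t, v j t) ∈ (segalField (coupling ρ e j)).graph) ∧
        Φ.ofLp = matAct (slash α p + (M : ℂ) • β) Ψ.ofLp + w - ∑ j, matAct (α j) (k j)
          - (q : ℂ) • ∑ j, matAct (α j) (v j) := by
  unfold hamiltonian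
  simp only [mem_graph_sub, mem_graph_add, mem_graph_smul, mem_graph_sum_three,
    mem_graph_tensorOp]
  constructor
  · rintro ⟨_, _, ⟨_, _, ⟨_, _, ⟨w0, hw0, rfl⟩, ⟨w, hw, rfl⟩, rfl⟩, ⟨a, ha, rfl⟩, rfl⟩,
      ⟨_, ⟨b, hb, rfl⟩, rfl⟩, rfl⟩
    choose k hk hk' using ha
    choose v hv hv' using hb
    refine ⟨w, k, v, hw, hk, hv, ?_⟩
    have h0 : w0 = Ψ.ofLp := by
      funext t
      obtain ⟨z, hz, hz'⟩ := (LinearPMap.mem_graph_iff _).1 (hw0 t)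
      exact hz'.symm.trans hz
    simp only [hk', hv', h0, WithLp.ofLp_sub, WithLp.ofLp_add, WithLp.ofLp_smul, WithLp.ofLp_sum,
      matAct_one]
    rfl
  · rintro ⟨w, k, v, hw, hk, hv, hΦ⟩
    refine ⟨_, _, ⟨_, _, ⟨_, _, ⟨Ψ.ofLp, fun t => ?_, rfl⟩, ⟨w, hw, rfl⟩, rfl⟩,
      ⟨fun j => WithLp.toLp 2 (matAct (α j) (k j)), fun j => ⟨k j, hk j, rfl⟩, rfl⟩, rfl⟩,
      ⟨_, ⟨fun j => WithLp.toLp 2 (matAct (α j) (v j)), fun j => ⟨v j, hv j, rfl⟩, rfl⟩, rfl⟩, ?_⟩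
    · exact (LinearPMap.mem_graph_iff _).2 ⟨⟨Ψ t, Submodule.mem_top⟩, rfl, rfl⟩
    · refine WithLp.ofLp_injective 2 (hΦ.trans ?_)
      simp only [WithLp.ofLp_sub, WithLp.ofLp_add, WithLp.ofLp_smul, WithLp.ofLp_sum, matAct_one]
      rfl

theorem abs_coord_le_omega (hm : 0 ≤ m) (j : Fin 3) (k : R3) : |k j| ≤ omega m k :=
  (PiLp.norm_apply_le k j).trans (norm_le_omega hm k)

/-- No term other than `dΓ(ω_m)` restricts the natural domain. -/
theorem exists_mem_graph_hamiltonian (he : IsPolarization e) (hρ : MemLp ρ 2 volume)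
    (hρ' : MemLp (fun k => ((‖k‖⁻¹ : ℝ) : ℂ) * ρ k) 2 volume) (hm : 0 ≤ m) {Ψ : Fibre}
    (hΨ : ∀ t, Ψ t ∈ (dGamma (omega m)).domain) :
    ∃ Φ, (Ψ, Φ) ∈ (hamiltonian α β e ρ M q m p).graph := by
  choose w hw using fun t => LinearPMap.mem_domain_iff.1 (hΨ t)
  have hk := fun (j : Fin 3) t => LinearPMap.mem_domain_iff.1
    (dGamma_domain_le (h' := fun k => k j) (by fun_prop) (abs_coord_le_omega hm j) (hΨ t))
  choose k hk using hk
  have hv : ∀ (j : Fin 3) t, ∃ v, (Ψ t, v) ∈ (segalField (coupling ρ e j)).graph := fun j t => by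
    obtain ⟨b, c, -, -, h⟩ :=
      mem_segalField_graph_unique (admissible_coupling he hρ hρ' hm j) (hΨ t)
    exact ⟨_, (h _).2 rfl⟩
  choose v hv using hv
  exact ⟨WithLp.toLp 2 _, mem_graph_hamiltonian.2 ⟨w, k, v, hw, hk, hv, rfl⟩⟩

variable {T : Matrix (Fin 3) (Fin 3) ℝ} {u : Matrix (Fin 4) (Fin 4) ℂ}

theorem IsDiracIntertwiner.mul_alpha (hu : IsDiracIntertwiner α β T u) (j : Fin 3) :
    u * α j = (∑ l, ((T l j : ℝ) : ℂ) • α l) * u := by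
  rw [← hu.alpha, mul_assoc, Matrix.mem_unitaryGroup_iff'.1 hu.unitary, mul_one]

theorem IsDiracIntertwiner.mul_beta (hu : IsDiracIntertwiner α β T u) : u * β = β * u := by
  conv_rhs => rw [← hu.beta]
  rw [mul_assoc _ (star u), Matrix.mem_unitaryGroup_iff'.1 hu.unitary, mul_one]

/-- Moving `u` to the right turns `αⱼ` into `∑ₗ Tₗⱼ αₗ`, and `T Tᵗ = 1` collapses the double sum. -/
theorem IsDiracIntertwiner.sum_smul_mul_alpha (hu : IsDiracIntertwiner α β T u)
    (hT : T ∈ Matrix.orthogonalGroup (Fin 3) ℝ) (i : Fin 3) :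
    ∑ j, ((T i j : ℝ) : ℂ) • (u * α j) = α i * u := by
  simp only [hu.mul_alpha, ← Matrix.smul_mul, ← Finset.sum_mul]
  congr 1
  simp only [Finset.smul_sum, smul_smul]
  rw [Finset.sum_comm]
  simp only [← Finset.sum_smul, ← Complex.ofReal_mul, ← Complex.ofReal_sum]
  have h : ∀ l, ∑ j, T i j * T l j = if i = l then 1 else 0 := by
    intro l
    have := congrFun (congrFun (mul_transpose_self hT) i) l
    rwa [Matrix.mul_apply, Matrix.one_apply] at this
  simp [h, ite_smul]

theorem IsDiracIntertwiner.mul_slash (hu : IsDiracIntertwiner α β T u) (p : R3) :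
    u * slash α p = slash α (act T p) * u := by
  have h : slash α (act T p) = ∑ j, ((p j : ℝ) : ℂ) • ∑ l, ((T l j : ℝ) : ℂ) • α l := by
    simp only [slash, act_apply, Complex.ofReal_sum, Complex.ofReal_mul, Finset.sum_smul,
      Finset.smul_sum, smul_smul]
    rw [Finset.sum_comm]
    simp only [mul_comm]
  rw [h, slash, Finset.mul_sum, Finset.sum_mul]
  simp only [Matrix.mul_smul, Matrix.smul_mul, hu.mul_alpha]

theorem matAct_rotate {F : Type*} [NormedAddCommGroup F] [InnerProductSpace ℂ F]
    (hu : IsDiracIntertwiner α β T u) (hT : T ∈ Matrix.orthogonalGroup (Fin 3) ℝ)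
    {k K : Fin 3 → Fin 4 → F} (h : ∀ j, k j = ∑ i, ((T i j : ℝ) : ℂ) • K i) :
    matAct u (∑ j, matAct (α j) (k j)) = ∑ i, matAct (α i) (matAct u (K i)) := by
  simp only [h, map_sum, map_smul, ← matAct_mul]
  rw [Finset.sum_comm]
  simp only [← matAct_sum_smul, hu.sum_smul_mul_alpha hT]

theorem matAct_hamiltonian {F : Type*} [NormedAddCommGroup F] [InnerProductSpace ℂ F]
    (hu : IsDiracIntertwiner α β T u) (hT : T ∈ Matrix.orthogonalGroup (Fin 3) ℝ)
    (G : F →ₗ[ℂ] F) {x w y : Fin 4 → F} {k v K A : Fin 3 → Fin 4 → F}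
    (hk : ∀ j, (fun t => G (k j t)) = ∑ i, ((T i j : ℝ) : ℂ) • K i)
    (hv : ∀ j, (fun t => G (v j t)) = ∑ i, ((T i j : ℝ) : ℂ) • A i)
    (hy : y = matAct (slash α p + (M : ℂ) • β) x + w - ∑ j, matAct (α j) (k j)
      - (q : ℂ) • ∑ j, matAct (α j) (v j)) :
    matAct u (fun t => G (y t))
      = matAct (slash α (act T p) + (M : ℂ) • β) (matAct u fun t => G (x t))
        + matAct u (fun t => G (w t)) - ∑ j, matAct (α j) (matAct u (K j))
        - (q : ℂ) • ∑ j, matAct (α j) (matAct u (A j)) := by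
  have hG : (fun t => G (y t)) = matAct (slash α p + (M : ℂ) • β) (fun t => G (x t))
      + (fun t => G (w t)) - ∑ j, matAct (α j) (fun t => G (k j t))
      - (q : ℂ) • ∑ j, matAct (α j) (fun t => G (v j t)) := by
    funext t
    have e1 : ∀ (C : Matrix (Fin 4) (Fin 4) ℂ) (x : Fin 4 → F),
        G (matAct C x t) = matAct C (fun t => G (x t)) t := fun C x =>
      congrFun (map_matAct G C x) t
    rw [hy]
    simp only [Pi.add_apply, Pi.sub_apply, Pi.smul_apply, Finset.sum_apply, map_add, map_sub,
      map_smul, map_sum, e1]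
  rw [hG, map_sub, map_sub, map_add, map_smul, matAct_rotate hu hT hk, matAct_rotate hu hT hv,
    ← matAct_mul, ← matAct_mul, mul_add, add_mul, hu.mul_slash, Matrix.mul_smul, Matrix.smul_mul,
    hu.mul_beta]

theorem omega_act (hT : T ∈ Matrix.orthogonalGroup (Fin 3) ℝ) (m : ℝ) (k : R3) :
    omega m (act T k) = omega m k := by
  rw [omega, omega, norm_act hT]

theorem RotationData.dGamma_omega_G (P : RotationData) {ψ φ : Fock}
    (h : (ψ, φ) ∈ (dGamma (omega m)).graph) : (P.G ψ, P.G φ) ∈ (dGamma (omega m)).graph := by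
  have h1 := P.dGamma_graph_G h
  simpa only [omega_act P.hTt] using h1

theorem matAct_mem_graph {A : Fock →ₗ.[ℂ] Fock} (C : Matrix (Fin 4) (Fin 4) ℂ)
    {x y : Fin 4 → Fock} (h : ∀ t, (x t, y t) ∈ A.graph) (s : Fin 4) :
    (matAct C x s, matAct C y s) ∈ A.graph := by
  have := A.graph.sum_mem (t := Finset.univ) fun t _ => A.graph.smul_mem (C s t) (h t)
  have e : (matAct C x s, matAct C y s) = ∑ t, C s t • (x t, y t) :=
    Prod.ext (by simp [matAct_apply, Prod.fst_sum]) (by simp [matAct_apply, Prod.snd_sum])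
  rwa [e]

/-- The photon unitary is applied to each spinor component first. The spinor matrix then mixes
components within one linear graph, so it creates no domain question. -/
theorem hamiltonian_graph_rotate (he : IsPolarization e) (hρ : MemLp ρ 2 volume)
    (hρ' : MemLp (fun k => ((‖k‖⁻¹ : ℝ) : ℂ) * ρ k) 2 volume) (hm : 0 ≤ m) {P : RotationData}
    (hrot : ∀ j, P.one.app (coupling ρ e j) =ᵐ[modeMeasure]
      fun x => ∑ i, ((P.T i j : ℝ) : ℂ) * coupling ρ e i x)
    (hu : IsDiracIntertwiner α β P.T u) {Ψ Φ : Fibre}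
    (h : (Ψ, Φ) ∈ (hamiltonian α β e ρ M q m p).graph) :
    (tensorUnitary u hu.unitary P.G Ψ, tensorUnitary u hu.unitary P.G Φ)
      ∈ (hamiltonian α β e ρ M q m (act P.T p)).graph := by
  obtain ⟨w, k, v, hw, hk, hv, hΦ⟩ := mem_graph_hamiltonian.1 h
  have hadm := fun j => admissible_coupling he hρ hρ' hm j
  have hGw := fun t => P.dGamma_omega_G (hw t)
  have hdom := fun t => LinearPMap.mem_domain_of_mem_graph (hw t)
  have hGdom := fun t => LinearPMap.mem_domain_of_mem_graph (hGw t)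
  have hK := fun (j : Fin 3) t => LinearPMap.mem_domain_iff.1
    (dGamma_domain_le (h' := fun k => k j) (by fun_prop) (abs_coord_le_omega hm j) (hGdom t))
  choose K hK using hK
  have hA : ∀ (j : Fin 3) t, ∃ v, (P.G (Ψ t), v) ∈ (segalField (coupling ρ e j)).graph :=
    fun j t => by
      obtain ⟨b, c, -, -, h⟩ := mem_segalField_graph_unique (hadm j) (hGdom t)
      exact ⟨_, (h _).2 rfl⟩
  choose A hA using hA
  have ek : ∀ j, (fun t => P.G (k j t)) = ∑ i, ((P.T i j : ℝ) : ℂ) • K i := by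
    intro j
    funext t
    rw [Finset.sum_apply]
    exact G_momentum_eq P (hk j t) fun i => hK i t
  have ev : ∀ j, (fun t => P.G (v j t)) = ∑ i, ((P.T i j : ℝ) : ℂ) • A i := by
    intro j
    funext t
    rw [Finset.sum_apply]
    exact G_segalField_eq P hadm (hrot j) (hdom t) (hGdom t) (hv j t) fun i => hA i t
  refine mem_graph_hamiltonian.2 ⟨matAct u fun t => P.G (w t), fun i => matAct u (K i),
    fun i => matAct u (A i), matAct_mem_graph u hGw, fun i => matAct_mem_graph u (hK i),
    fun i => matAct_mem_graph u (hA i), ?_⟩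
  exact matAct_hamiltonian hu P.hT (P.G : Fock →ₗ[ℂ] Fock) ek ev hΦ

theorem intertwines_hamiltonian (he : IsPolarization e) (hρ : MemLp ρ 2 volume)
    (hρ' : MemLp (fun k => ((‖k‖⁻¹ : ℝ) : ℂ) * ρ k) 2 volume) (hm : 0 ≤ m) {P : RotationData}
    (hrot : ∀ j, P.one.app (coupling ρ e j) =ᵐ[modeMeasure]
      fun x => ∑ i, ((P.T i j : ℝ) : ℂ) * coupling ρ e i x)
    (hu : IsDiracIntertwiner α β P.T u) :
    Intertwines (tensorUnitary u hu.unitary P.G) (hamiltonian α β e ρ M q m p)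
      (hamiltonian α β e ρ M q m (act P.T p)) := by
  intro x y
  refine ⟨hamiltonian_graph_rotate he hρ hρ' hm hrot hu, fun h => ?_⟩
  -- For the converse it suffices that `x` lies in the domain at momentum `p`: the forward
  -- implication then gives a value at `U x`, which must be `U y` by uniqueness. Only the invariance
  -- of the domain of `dΓ(ω_m)` under the inverse is used.
  obtain ⟨w, -, -, hw, -, -, -⟩ := mem_graph_hamiltonian.1 h
  have hx : ∀ t, x t ∈ (dGamma (omega m)).domain := by
    intro t
    have h1 := P.inv.dGamma_omega_G (matAct_mem_graph (star u) hw t)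
    rw [← P.G_symm_apply, ← apply_eq_symm_matAct u hu.unitary P.G x t] at h1
    exact LinearPMap.mem_domain_of_mem_graph h1
  obtain ⟨z, hz⟩ := exists_mem_graph_hamiltonian (α := α) (β := β) (M := M) (q := q) (p := p)
    he hρ hρ' hm hx
  have h3 := hamiltonian_graph_rotate he hρ hρ' hm hrot hu hz
  have h4 := LinearPMap.mem_graph_snd_inj _ h h3 rfl
  rw [(tensorUnitary u hu.unitary P.G).injective h4]
  exact hz

end Hamiltonian

end DiracPolaron

end

/-! ### The symmetry in the total momentum -/

theorem propositionP1p6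
    (α : Fin 3 → Matrix (Fin 4) (Fin 4) ℂ) (β : Matrix (Fin 4) (Fin 4) ℂ)
    (hD : DiracPolaron.IsDirac α β)
    (e : Fin 2 → DiracPolaron.R3 → DiracPolaron.R3) (he : DiracPolaron.IsPolarization e)
    (ρ : DiracPolaron.R3 → ℂ) (hρ : MemLp ρ 2 volume)
    (hρ' : MemLp (fun k => ((‖k‖⁻¹ : ℝ) : ℂ) * ρ k) 2 volume)
    (M q m : ℝ) (hm : 0 ≤ m)
    (T : Matrix (Fin 3) (Fin 3) ℝ) (hT : T ∈ Matrix.orthogonalGroup (Fin 3) ℝ)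
    (hsymm : ∀ᵐ k : DiracPolaron.R3, ‖ρ k‖ = ‖ρ (DiracPolaron.act T k)‖)
    (p : DiracPolaron.R3) :
    (∃ U : DiracPolaron.Fibre ≃ₗᵢ[ℂ] DiracPolaron.Fibre,
      DiracPolaron.Intertwines U
        (DiracPolaron.hamiltonian α β e ρ M q m p).closure
        (DiracPolaron.hamiltonian α β e ρ M q m (DiracPolaron.act T p)).closure ∧
      ∃ (u : Matrix (Fin 4) (Fin 4) ℂ)
        (W : DiracPolaron.OnePhoton ≃ₗᵢ[ℂ] DiracPolaron.OnePhoton)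
        (G : DiracPolaron.Fock ≃ₗᵢ[ℂ] DiracPolaron.Fock),
        DiracPolaron.IsDiracIntertwiner α β T u ∧
        DiracPolaron.IsPhotonRotation T W ∧
        DiracPolaron.IsSecondQuantization W G ∧
        DiracPolaron.IsTensor u G U) ∧
    DiracPolaron.energy α β e ρ M q m p
      = DiracPolaron.energy α β e ρ M q m (DiracPolaron.act T p) := by
  obtain ⟨P, rfl, hrot⟩ := DiracPolaron.exists_rotationData he hρ.1 hT hsymm
  obtain ⟨u, hu⟩ := DiracPolaron.exists_isDiracIntertwiner hD (DiracPolaron.actIsometry P.T P.hT)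
  rw [DiracPolaron.isometryMatrix_actIsometry] at hu
  have h := (DiracPolaron.intertwines_hamiltonian (M := M) (q := q) (p := p)
    he hρ hρ' hm hrot hu).closure
  exact ⟨⟨_, h, u, P.W, P.G, hu, P.isPhotonRotation_W, P.isSecondQuantization_G,
    fun _ _ => rfl⟩, h.infSpectrum_eq⟩
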